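/- Let $1<\beta<2$ and $r<0$. For $f$ twice continuously differentiable on $(0,\infty)$ let $$(D^{\beta}f)(t)=\frac{1}{\Gamma(2-\beta)}\int_0^t (t-\tau)^{1-\beta}f''(\tau)\,d\tau,\qquad t>0,$$ be its Caputo derivative of order $\beta$, defined when the integral converges (absolutely) for every $t>0$, and let $$E_{\alpha}(z)=\sum_{k=0}^\infty\frac{z^k}{\Gamma(k\alpha+1)},\qquad E_{\alpha,\gamma}(z)=\sum_{k=0}^\infty\frac{z^k}{\Gamma(k\alpha+\gamma)}$$ be the Mittag-Leffler functions. Then the initial value problem $$D^{\beta}u(t)-r\,u(t)=0\quad(t>0),\qquad u(0)=1,\quad u'(0)=1$$ (with $u'(0)$ the one-sided derivative at $0$) has exactly one solution on $[0,\infty)$, namely $$u(t)=E_{\beta}(rt^{\beta})+t\,E_{\beta,2}(rt^{\beta}),$$ the limit $\lim_{t\to\infty} t\,u'(t)/u(t)$ exists, and $$\beta=1-\lim_{t\to\infty}\frac{t\,u'(t)}{u(t)}.$$ -/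

import Mathlib

open Set Filter Topology MeasureTheory

noncomputable section

/-- The two-parameter Mittag-Leffler function `E_{α,β}(z) = ∑_{k ≥ 0} z ^ k / Γ(k α + β)`,
for real `α > 0`, `β > 0` and real `z` (the series then converges absolutely). -/
def mittagLeffler₂ (α β z : ℝ) : ℝ :=
  ∑' k : ℕ, z ^ k / Real.Gamma (k * α + β)

/-- The one-parameter Mittag-Leffler function `E_α(z) = ∑_{k ≥ 0} z ^ k / Γ(k α + 1)`. -/
def mittagLeffler (α z : ℝ) : ℝ :=
  ∑' k : ℕ, z ^ k / Real.Gamma (k * α + 1)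

/-- The integrand `τ ↦ (t - τ) ^ (n - β - 1) * f⁽ⁿ⁾(τ)` of the Caputo derivative of non-integer
order `β > 0`, where `n = ⌈β⌉`, that is, `n - 1 < β < n`. -/
def caputoIntegrand (β : ℝ) (f : ℝ → ℝ) (t τ : ℝ) : ℝ :=
  (t - τ) ^ ((⌈β⌉₊ : ℝ) - β - 1) * iteratedDeriv ⌈β⌉₊ f τ

/-- The Caputo derivative with lower terminal `t₀` and non-integer order `β > 0`, at `t > t₀`:
`1 / Γ(n - β) * ∫_{t₀}^t (t - τ) ^ (n - β - 1) f⁽ⁿ⁾(τ) dτ` with `n = ⌈β⌉`. Only the values of `f`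
on `(t₀, ∞)` matter. -/
def caputoDeriv (t₀ β : ℝ) (f : ℝ → ℝ) (t : ℝ) : ℝ :=
  1 / Real.Gamma ((⌈β⌉₊ : ℝ) - β) * ∫ τ in t₀..t, caputoIntegrand β f t τ

/-- The functions whose Caputo derivative of order `β` is defined on all of `(t₀, ∞)`: `f` has
`n = ⌈β⌉` continuous derivatives on `(t₀, ∞)`, and the defining integral exists at every
`t > t₀`. -/
structure CaputoDifferentiable (t₀ β : ℝ) (f : ℝ → ℝ) : Prop where
  contDiffOn : ContDiffOn ℝ (⌈β⌉₊ : ℕ) f (Ioi t₀)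
  integrable : ∀ t, t₀ < t → IntervalIntegrable (caputoIntegrand β f t) volume t₀ t

/-- `u` solves, on `[0, ∞)`, the initial value problem `D^β u - r u = 0`, `u(0) = u₀`,
`u'(0) = u₁` with the Caputo derivative of order `β ∈ (1, 2)` with lower terminal `0`
(`u'(0)` is the one-sided derivative). -/
structure IsCaputoSolution (β r u₀ u₁ : ℝ) (u : ℝ → ℝ) : Prop where
  caputoDifferentiable : CaputoDifferentiable 0 β u
  equation : ∀ t, 0 < t → caputoDeriv 0 β u t - r * u t = 0
  init : u 0 = u₀
  init_deriv : HasDerivWithinAt u u₁ (Ici 0) 0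

end

/-! Put P_γ(t) = t^(γ-1) E_{β,γ}(r t^β) (`mittagLefflerPower`), so that the claimed solution is P_1
+ P_2. Differentiation lowers γ by one, fractional integration of order p raises it by p, and P_γ =
t^(γ-1)/Γ(γ) + r P_{β+γ}. Because 1/Γ vanishes at -1 and 0, the second derivative P_{-1} + P_0
equals r (P_{β-1} + P_β), and integrating to order 2-β returns r (P_1 + P_2).

Uniqueness: applying the fractional integral of order β to the equation turns it, by the semigroup
law `integral_rpow_mul_integral_rpow_mul`, into a Volterra equation
(`IsCaputoSolution.eq_add_integral`) whose kernel is bounded since β > 1. Grönwall's inequality then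
kills the difference of two solutions.

Limit: `tendsto_mul_mittagLeffler₂_neg` gives x E_{β,γ}(-x) → 1/Γ(γ-β). Hence P_1 and P_2 have
leading coefficients 1/Γ(1-β) and 1/Γ(2-β), and t u'/u = t (P_0 + P_1)/(P_1 + P_2) tends to
Γ(2-β)/Γ(1-β) = 1-β. By the recurrence in γ, the asymptotics need only the decay of E_{β,γ}(-x) for
every real γ. That comes from Hankel's integral for 1/Γ, summed to a contour integral for E_{β,γ}
whose integrand is O(1/x).

`Real.Gamma` is 0 at its poles, so 1/Γ is the entire reciprocal Gamma function and the identities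
hold for all real γ. -/

noncomputable section

/-! ### Hankel's contour integral for 1/Γ -/

open Complex in
/-- The integral of `F` over the contour coming in from `+∞` along the line `Im w = -θ`,
crossing to the line `Im w = θ` at `Re w = a`, and returning to `+∞`. -/
def hankelIntegral (θ a : ℝ) (F : ℂ → ℂ) : ℂ :=
  I * (∫ y in (-θ)..θ, F (a + y * I)) +
    ((∫ u in Ioi a, F (u + θ * I)) - ∫ u in Ioi a, F (u + ((-θ : ℝ) : ℂ) * I))

open Complex in
/-- The integrand of Hankel's formula for `1 / Γ(z)` in the logarithmic coordinate. -/
def hankelKernel (z : ℝ) (w : ℂ) : ℂ := exp (exp w) * exp (w * ((1 - z : ℝ) : ℂ))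

lemma norm_hankelKernel (z u y : ℝ) :
    ‖hankelKernel z (u + y * Complex.I)‖ =
      Real.exp (Real.exp u * Real.cos y + u * (1 - z)) := by
  rw [hankelKernel, norm_mul, Complex.norm_exp, Complex.norm_exp, ← Real.exp_add,
    Complex.re_mul_ofReal, Complex.exp_re]
  simp

lemma differentiable_hankelKernel (z : ℝ) : Differentiable ℂ (hankelKernel z) := by
  unfold hankelKernel
  fun_prop

lemma continuous_hankelKernel (z : ℝ) : Continuous (hankelKernel z) :=
  (differentiable_hankelKernel z).continuous

/-- The bound e^u ≥ 1 + u + u²/2 followed by completing the square. It supplies the integrable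
majorant on every ray with negative cosine. -/
lemma exp_neg_mul_exp_add_le {c : ℝ} (hc : 0 < c) (m : ℝ) {u : ℝ} (hu : 0 ≤ u) :
    Real.exp (-c * Real.exp u + m * u) ≤ Real.exp ((m + 1) ^ 2 / (2 * c)) * Real.exp (-u) := by
  rw [← Real.exp_add]
  apply Real.exp_le_exp.2
  have h1 := Real.quadratic_le_exp_of_nonneg hu
  have h2 : c * (1 + u + u ^ 2 / 2) ≤ c * Real.exp u := mul_le_mul_of_nonneg_left h1 hc.le
  have h3 : (m + 1) * u ≤ (m + 1) ^ 2 / (2 * c) + c * u ^ 2 / 2 := by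
    have : (m + 1) ^ 2 / (2 * c) + c * u ^ 2 / 2 - (m + 1) * u
        = (m + 1 - c * u) ^ 2 / (2 * c) := by field_simp; ring
    have : 0 ≤ (m + 1 - c * u) ^ 2 / (2 * c) := by positivity
    linarith
  nlinarith [mul_nonneg hc.le hu]

lemma integrableOn_exp_neg_mul_exp_add {c : ℝ} (hc : 0 < c) (m a : ℝ) :
    IntegrableOn (fun u => Real.exp (-c * Real.exp u + m * u)) (Ioi a) := by
  apply integrable_of_isBigO_exp_neg (b := 1) one_pos (by fun_prop)
  apply Asymptotics.IsBigO.of_bound (Real.exp ((m + 1) ^ 2 / (2 * c)))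
  filter_upwards [eventually_ge_atTop 0] with u hu
  simpa using exp_neg_mul_exp_add_le hc m hu

lemma tendsto_exp_neg_mul_exp_add {c : ℝ} (hc : 0 < c) (m : ℝ) :
    Tendsto (fun u => Real.exp (-c * Real.exp u + m * u)) atTop (𝓝 0) := by
  refine squeeze_zero' (Eventually.of_forall fun _ => (Real.exp_pos _).le)
    ((eventually_ge_atTop 0).mono fun u hu => exp_neg_mul_exp_add_le hc m hu) ?_
  simpa using (Real.tendsto_exp_neg_atTop_nhds_zero).const_mul (Real.exp ((m + 1) ^ 2 / (2 * c)))

lemma integrableOn_hankelKernel {y : ℝ} (hy : Real.cos y < 0) (z a : ℝ) :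
    IntegrableOn (fun u : ℝ => hankelKernel z (u + y * Complex.I)) (Ioi a) := by
  have h := integrableOn_exp_neg_mul_exp_add (neg_pos.2 hy) (1 - z) a
  refine Integrable.mono' h ?_ (Eventually.of_forall fun u => ?_)
  · exact ((continuous_hankelKernel z).comp (by fun_prop)).aestronglyMeasurable
  · rw [norm_hankelKernel]
    apply le_of_eq; congr 1; ring

/-- Cauchy's theorem on a rectangle. Differentiability is asked only there, since the Mittag-Leffler
kernel has poles elsewhere. -/
lemma hankelIntegral_shift {θ a b : ℝ} (hθ : 0 ≤ θ) (hab : a ≤ b) {F : ℂ → ℂ}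
    (hF : ∀ w : ℂ, w.re ∈ Icc a b → w.im ∈ Icc (-θ) θ → DifferentiableAt ℂ F w)
    (h1 : IntegrableOn (fun u : ℝ => F (u + θ * Complex.I)) (Ioi a))
    (h2 : IntegrableOn (fun u : ℝ => F (u + ((-θ : ℝ) : ℂ) * Complex.I)) (Ioi a)) :
    hankelIntegral θ a F = hankelIntegral θ b F := by
  have h := Complex.integral_boundary_rect_eq_zero_of_differentiableOn F
    (⟨a, -θ⟩ : ℂ) (⟨b, θ⟩ : ℂ) (by
      intro w hw
      rw [Complex.mem_reProdIm, uIcc_of_le hab, uIcc_of_le (by simpa using hθ)] at hw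
      exact (hF w hw.1 hw.2).differentiableWithinAt)
  simp only [smul_eq_mul] at h
  have e1 := intervalIntegral.integral_interval_add_Ioi h1 (h1.mono_set (Ioi_subset_Ioi hab))
  have e2 := intervalIntegral.integral_interval_add_Ioi h2 (h2.mono_set (Ioi_subset_Ioi hab))
  rw [hankelIntegral, hankelIntegral, ← e1, ← e2]
  linear_combination -h

lemma ray_integral_sub {θ₁ θ₂ a : ℝ} {F : ℂ → ℂ} (hF : Differentiable ℂ F)
    (h1 : IntegrableOn (fun u : ℝ => F (u + θ₁ * Complex.I)) (Ioi a))
    (h2 : IntegrableOn (fun u : ℝ => F (u + θ₂ * Complex.I)) (Ioi a))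
    (h3 : Tendsto (fun b : ℝ => ∫ y in θ₁..θ₂, F (b + y * Complex.I)) atTop (𝓝 0)) :
    (∫ u in Ioi a, F (u + θ₁ * Complex.I)) - (∫ u in Ioi a, F (u + θ₂ * Complex.I)) =
      Complex.I * ∫ y in θ₁..θ₂, F (a + y * Complex.I) := by
  have t1 := intervalIntegral_tendsto_integral_Ioi a h1 tendsto_id
  have t2 := intervalIntegral_tendsto_integral_Ioi a h2 tendsto_id
  have t3 := (t1.sub t2).add (h3.const_mul Complex.I)
  have t4 : Tendsto (fun _ : ℝ => Complex.I * ∫ y in θ₁..θ₂, F (a + y * Complex.I)) atTop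
      (𝓝 ((∫ u in Ioi a, F (u + θ₁ * Complex.I)) - (∫ u in Ioi a, F (u + θ₂ * Complex.I))
        + Complex.I * 0)) := by
    refine t3.congr fun b => ?_
    have h := Complex.integral_boundary_rect_eq_zero_of_differentiableOn F
      (⟨a, θ₁⟩ : ℂ) (⟨b, θ₂⟩ : ℂ) hF.differentiableOn
    simp only [smul_eq_mul] at h
    simp only [id]
    linear_combination h
  have := tendsto_nhds_unique t4 tendsto_const_nhds
  simpa using this

lemma hankelIntegral_congr_angle {θ₁ θ₂ a : ℝ} {F : ℂ → ℂ} (hF : Differentiable ℂ F)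
    (h1 : IntegrableOn (fun u : ℝ => F (u + θ₁ * Complex.I)) (Ioi a))
    (h2 : IntegrableOn (fun u : ℝ => F (u + θ₂ * Complex.I)) (Ioi a))
    (h1' : IntegrableOn (fun u : ℝ => F (u + ((-θ₁ : ℝ) : ℂ) * Complex.I)) (Ioi a))
    (h2' : IntegrableOn (fun u : ℝ => F (u + ((-θ₂ : ℝ) : ℂ) * Complex.I)) (Ioi a))
    (h3 : Tendsto (fun b : ℝ => ∫ y in θ₁..θ₂, F (b + y * Complex.I)) atTop (𝓝 0))
    (h3' : Tendsto (fun b : ℝ => ∫ y in (-θ₁)..(-θ₂), F (b + y * Complex.I)) atTop (𝓝 0)) :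
    hankelIntegral θ₁ a F = hankelIntegral θ₂ a F := by
  have e1 := ray_integral_sub hF h1 h2 h3
  have e2 := ray_integral_sub hF h1' h2' h3'
  have hc : Continuous fun y : ℝ => F (a + y * Complex.I) := hF.continuous.comp (by fun_prop)
  have e3 := intervalIntegral.integral_add_adjacent_intervals
    (hc.intervalIntegrable (μ := volume) (-θ₁) (-θ₂)) (hc.intervalIntegrable (-θ₂) θ₂)
  have e4 := intervalIntegral.integral_add_adjacent_intervals
    (hc.intervalIntegrable (μ := volume) (-θ₁) θ₁) (hc.intervalIntegrable θ₁ θ₂)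
  rw [hankelIntegral, hankelIntegral]
  linear_combination e1 - e2 + Complex.I * (e4 - e3)

lemma tendsto_integral_hankelKernel_atTop {θ₁ θ₂ c : ℝ} (hc : 0 < c)
    (h : ∀ y ∈ uIoc θ₁ θ₂, Real.cos y ≤ -c) (z : ℝ) :
    Tendsto (fun b : ℝ => ∫ y in θ₁..θ₂, hankelKernel z (b + y * Complex.I)) atTop (𝓝 0) := by
  have ht := (tendsto_exp_neg_mul_exp_add hc (1 - z)).mul_const |θ₂ - θ₁|
  rw [zero_mul] at ht
  refine squeeze_zero_norm (fun b => ?_) ht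
  apply intervalIntegral.norm_integral_le_of_norm_le_const
  intro y hy
  rw [norm_hankelKernel]
  apply Real.exp_le_exp.2
  nlinarith [h y hy, Real.exp_pos b]

lemma cos_le_cos_of_mem_Icc {θ y : ℝ} (h0 : 0 ≤ θ) (hy : y ∈ Icc θ Real.pi) :
    Real.cos y ≤ Real.cos θ :=
  Real.cos_le_cos_of_nonneg_of_le_pi h0 hy.2 hy.1

lemma cos_neg_of_pi_div_two_lt {θ : ℝ} (h1 : Real.pi / 2 < θ) (h2 : θ ≤ Real.pi) :
    Real.cos θ < 0 :=
  Real.cos_neg_of_pi_div_two_lt_of_lt h1 (by linarith [Real.pi_pos])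

lemma hankelIntegral_hankelKernel_angle {θ : ℝ} (h1 : Real.pi / 2 < θ) (h2 : θ ≤ Real.pi)
    (z a : ℝ) :
    hankelIntegral θ a (hankelKernel z) = hankelIntegral Real.pi a (hankelKernel z) := by
  have hc := cos_neg_of_pi_div_two_lt h1 h2
  have hp : Real.cos Real.pi < 0 := by simp
  have h0 : 0 ≤ θ := by linarith [Real.pi_pos]
  apply hankelIntegral_congr_angle (differentiable_hankelKernel z)
  · exact integrableOn_hankelKernel hc z a
  · exact integrableOn_hankelKernel hp z a
  · exact integrableOn_hankelKernel (by rwa [Real.cos_neg]) z a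
  · exact integrableOn_hankelKernel (by rwa [Real.cos_neg]) z a
  · apply tendsto_integral_hankelKernel_atTop (neg_pos.2 hc)
    intro y hy
    rw [uIoc_of_le h2] at hy
    rw [neg_neg]
    exact cos_le_cos_of_mem_Icc h0 ⟨hy.1.le, hy.2⟩
  · apply tendsto_integral_hankelKernel_atTop (neg_pos.2 hc)
    intro y hy
    rw [uIoc_of_ge (by linarith)] at hy
    rw [neg_neg, ← Real.cos_neg y]
    exact cos_le_cos_of_mem_Icc h0 ⟨by linarith [hy.2], by linarith [hy.1]⟩

/-- The derivative of `hankelKernel z` is the difference of the two integrands. Its boundary values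
vanish at infinity and cancel at the two corners of the contour. -/
lemma hankelIntegral_hankelKernel_sub_one {θ : ℝ} (hθ : Real.cos θ < 0) (z a : ℝ) :
    hankelIntegral θ a (hankelKernel (z - 1)) =
      ((z - 1 : ℝ) : ℂ) * hankelIntegral θ a (hankelKernel z) := by
  have hG : ∀ w, HasDerivAt (hankelKernel z)
      (hankelKernel (z - 1) w - ((z - 1 : ℝ) : ℂ) * hankelKernel z w) w := by
    intro w
    have h := ((Complex.hasDerivAt_exp w).cexp).mul
      (((hasDerivAt_id w).mul_const ((1 - z : ℝ) : ℂ)).cexp)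
    refine h.congr_deriv ?_
    have : w * ((1 - (z - 1) : ℝ) : ℂ) = w + w * ((1 - z : ℝ) : ℂ) := by push_cast; ring
    simp only [hankelKernel, this, Complex.exp_add, id]
    push_cast
    ring
  have hray : ∀ y : ℝ, Real.cos y < 0 →
      (∫ u in Ioi a, hankelKernel (z - 1) (u + y * Complex.I)) -
        ((z - 1 : ℝ) : ℂ) * (∫ u in Ioi a, hankelKernel z (u + y * Complex.I)) =
      - hankelKernel z (a + y * Complex.I) := by
    intro y hy
    rw [← integral_const_mul, ← integral_sub (integrableOn_hankelKernel hy _ a)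
      ((integrableOn_hankelKernel hy _ a).const_mul _)]
    rw [← zero_sub]
    refine integral_Ioi_of_hasDerivAt_of_tendsto'
      (f := fun u : ℝ => hankelKernel z (u + y * Complex.I)) (fun u _ => ?_) ?_ ?_
    · have := (hG (u + y * Complex.I)).comp_add_const (u : ℂ) (y * Complex.I)
      exact this.comp_ofReal
    · exact (integrableOn_hankelKernel hy _ a).sub ((integrableOn_hankelKernel hy _ a).const_mul _)
    · rw [tendsto_zero_iff_norm_tendsto_zero]
      refine (tendsto_exp_neg_mul_exp_add (neg_pos.2 hy) (1 - z)).congr fun u => ?_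
      rw [norm_hankelKernel]
      congr 1; ring
  have hseg : Complex.I * (∫ y in (-θ)..θ, hankelKernel (z - 1) (a + y * Complex.I)) -
      ((z - 1 : ℝ) : ℂ) * (Complex.I * ∫ y in (-θ)..θ, hankelKernel z (a + y * Complex.I)) =
      hankelKernel z (a + θ * Complex.I) - hankelKernel z (a + ((-θ : ℝ) : ℂ) * Complex.I) := by
    have hc : ∀ x, Continuous fun y : ℝ => hankelKernel x (a + y * Complex.I) :=
      fun x => (continuous_hankelKernel x).comp (by fun_prop)
    rw [mul_left_comm, ← mul_sub, ← intervalIntegral.integral_const_mul,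
      ← intervalIntegral.integral_sub ((hc _).intervalIntegrable _ _)
        (((hc _).const_mul _).intervalIntegrable _ _), ← intervalIntegral.integral_const_mul]
    refine intervalIntegral.integral_eq_sub_of_hasDerivAt
      (f := fun y : ℝ => hankelKernel z (a + y * Complex.I)) (fun y _ => ?_) ?_
    · have h1 : HasDerivAt (fun y : ℂ => (a : ℂ) + y * Complex.I) Complex.I (y : ℂ) := by
        simpa using ((hasDerivAt_id (y : ℂ)).mul_const Complex.I).const_add (a : ℂ)
      have := (hG (a + y * Complex.I)).comp (y : ℂ) h1
      rw [mul_comm] at this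
      exact this.comp_ofReal
    · exact (continuous_const.mul ((hc _).sub ((hc _).const_mul _))).intervalIntegrable _ _
  have r1 := hray θ hθ
  have r2 := hray (-θ) (by rwa [Real.cos_neg])
  rw [hankelIntegral, hankelIntegral]
  linear_combination hseg + r1 - r2

lemma hankelKernel_pi (z u : ℝ) :
    hankelKernel z (u + Real.pi * Complex.I) =
      Complex.exp (Real.pi * (1 - z : ℝ) * Complex.I) *
        (Real.exp (-Real.exp u) * Real.exp (u * (1 - z)) : ℝ) := by
  rw [hankelKernel, Complex.exp_add, Complex.exp_pi_mul_I, add_mul, Complex.exp_add]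
  push_cast
  ring_nf

lemma hankelKernel_neg_pi (z u : ℝ) :
    hankelKernel z (u + ((-Real.pi : ℝ) : ℂ) * Complex.I) =
      Complex.exp (-(Real.pi * (1 - z : ℝ) * Complex.I)) *
        (Real.exp (-Real.exp u) * Real.exp (u * (1 - z)) : ℝ) := by
  rw [hankelKernel, Complex.exp_add, Complex.ofReal_neg, neg_mul, Complex.exp_neg,
    Complex.exp_pi_mul_I, add_mul, Complex.exp_add]
  push_cast
  ring_nf

/-- On Im w = ±π one has e^w = -e^u, so both rays carry the same real integrand with conjugate
phases, and their difference produces the sine. -/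
lemma hankelIntegral_pi (z a : ℝ) :
    hankelIntegral Real.pi a (hankelKernel z) =
      Complex.I * (∫ y in (-Real.pi)..Real.pi, hankelKernel z (a + y * Complex.I)) +
      2 * Complex.I * (Real.sin (Real.pi * (1 - z)) *
        ∫ u in Ioi a, Real.exp (-Real.exp u) * Real.exp (u * (1 - z)) : ℝ) := by
  rw [hankelIntegral]
  simp_rw [hankelKernel_pi, hankelKernel_neg_pi, integral_const_mul, integral_complex_ofReal]
  have : Complex.exp (Real.pi * (1 - z : ℝ) * Complex.I) -
      Complex.exp (-(Real.pi * (1 - z : ℝ) * Complex.I)) =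
      2 * Complex.I * Real.sin (Real.pi * (1 - z)) := by
    rw [← neg_mul, Complex.exp_mul_I, Complex.exp_mul_I, Complex.cos_neg, Complex.sin_neg]
    push_cast
    ring
  rw [← sub_mul, this]
  push_cast
  ring

lemma integral_exp_neg_exp (s a : ℝ) :
    ∫ u in Ioi a, Real.exp (-Real.exp u) * Real.exp (u * s) =
      ∫ t in Ioi (Real.exp a), Real.exp (-t) * t ^ (s - 1) := by
  rw [← integral_comp_exp_Ioi]
  refine integral_congr_ae (Eventually.of_forall fun u => ?_)
  simp only [smul_eq_mul]
  have : Real.exp (u * s) = Real.exp u * Real.exp (u * (s - 1)) := by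
    rw [← Real.exp_add]; congr 1; ring
  rw [← Real.exp_mul, this]
  ring

lemma tendsto_integral_exp_neg_exp {s : ℝ} (hs : 0 < s) :
    Tendsto (fun a => ∫ u in Ioi a, Real.exp (-Real.exp u) * Real.exp (u * s)) atBot
      (𝓝 (Real.Gamma s)) := by
  simp_rw [integral_exp_neg_exp, Real.Gamma_eq_integral hs]
  have hi := Real.GammaIntegral_convergent hs
  have hI : ∀ a : ℝ, ∫ t in Ioi (Real.exp a), Real.exp (-t) * t ^ (s - 1) =
      (∫ t in Ioi 0, Real.exp (-t) * t ^ (s - 1)) -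
        ∫ t in 0..Real.exp a, Real.exp (-t) * t ^ (s - 1) := fun a => by
    rw [← intervalIntegral.integral_Ioi_sub_Ioi hi (Real.exp_pos a).le]; ring
  simp_rw [hI]
  have hint : IntervalIntegrable (fun t => Real.exp (-t) * t ^ (s - 1)) volume 0 1 := by
    rw [intervalIntegrable_iff_integrableOn_Ioc_of_le zero_le_one]
    exact hi.mono_set Ioc_subset_Ioi_self
  have hcont := intervalIntegral.continuousOn_primitive_interval' hint left_mem_uIcc
  have h0 := (hcont 0 left_mem_uIcc).tendsto
  rw [intervalIntegral.integral_same] at h0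
  have hexp : Tendsto Real.exp atBot (𝓝[uIcc 0 1] 0) := by
    refine tendsto_nhdsWithin_iff.2 ⟨Real.tendsto_exp_atBot, ?_⟩
    filter_upwards [eventually_le_atBot 0] with a ha
    rw [uIcc_of_le zero_le_one]
    exact ⟨(Real.exp_pos a).le, Real.exp_le_one_iff.2 ha⟩
  simpa using (h0.comp hexp).const_sub (∫ t in Ioi 0, Real.exp (-t) * t ^ (s - 1))

lemma one_div_Gamma_eq {z : ℝ} (hz : z < 1) :
    1 / Real.Gamma z = Real.Gamma (1 - z) * Real.sin (Real.pi * z) / Real.pi := by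
  have h := Real.Gamma_mul_Gamma_one_sub z
  have hg : 0 < Real.Gamma (1 - z) := Real.Gamma_pos_of_pos (by linarith)
  have hp := Real.pi_pos
  -- At a pole of Γ both sides are 0 by convention.
  by_cases hs : Real.sin (Real.pi * z) = 0
  · rw [hs, div_zero, mul_eq_zero, or_iff_left hg.ne'] at h
    rw [hs, h]; simp
  · have hz : Real.Gamma z ≠ 0 := by
      intro h0
      rw [h0, zero_mul] at h
      exact (div_ne_zero hp.ne' hs) h.symm
    rw [eq_div_iff hs] at h
    rw [div_eq_div_iff hz hp.ne']
    linarith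

/-- The contour can be moved to a → -∞: as 1 - z > 0 the vertical segment disappears, the rays give
sin(πz) Γ(1-z), and the reflection formula concludes. -/
lemma hankelIntegral_hankelKernel_of_lt_one {z : ℝ} (hz : z < 1) (a : ℝ) :
    hankelIntegral Real.pi a (hankelKernel z) =
      2 * Complex.I * (Real.pi * (1 / Real.Gamma z) : ℝ) := by
  have hp : Real.cos Real.pi < 0 := by simp
  have hs : 0 < 1 - z := by linarith
  have t1 : Tendsto (fun b : ℝ => ∫ y in (-Real.pi)..Real.pi, hankelKernel z (b + y * Complex.I))
      atBot (𝓝 0) := by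
    have ht : Tendsto (fun b : ℝ => Real.exp (Real.exp b + b * (1 - z)) * |Real.pi - -Real.pi|)
        atBot (𝓝 0) := by
      have h1 : Tendsto (fun b : ℝ => Real.exp b + b * (1 - z)) atBot atBot :=
        Real.tendsto_exp_atBot.add_atBot (tendsto_id.atBot_mul_const hs)
      simpa using (Real.tendsto_exp_atBot.comp h1).mul_const |Real.pi - -Real.pi|
    refine squeeze_zero_norm (fun b => ?_) ht
    apply intervalIntegral.norm_integral_le_of_norm_le_const
    intro y _
    rw [norm_hankelKernel]
    apply Real.exp_le_exp.2
    nlinarith [Real.cos_le_one y, Real.exp_pos b]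
  have t2 := tendsto_integral_exp_neg_exp hs
  have t3 : Tendsto (fun b => hankelIntegral Real.pi b (hankelKernel z)) atBot
      (𝓝 (Complex.I * 0 + 2 * Complex.I *
        (Real.sin (Real.pi * (1 - z)) * Real.Gamma (1 - z) : ℝ))) := by
    simp_rw [hankelIntegral_pi]
    exact (t1.const_mul _).add
      (((Complex.continuous_ofReal.tendsto _).comp (t2.const_mul _)).const_mul _)
  have t4 : Tendsto (fun b => hankelIntegral Real.pi b (hankelKernel z)) atBot
      (𝓝 (hankelIntegral Real.pi a (hankelKernel z))) := by
    refine tendsto_const_nhds.congr' ?_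
    filter_upwards [eventually_le_atBot a] with b hb
    exact (hankelIntegral_shift Real.pi_pos.le hb
      (fun w _ _ => (differentiable_hankelKernel z) w) (integrableOn_hankelKernel hp z b)
      (integrableOn_hankelKernel (by rwa [Real.cos_neg]) z b)).symm
  rw [tendsto_nhds_unique t4 t3, one_div_Gamma_eq hz]
  have : Real.sin (Real.pi * (1 - z)) = Real.sin (Real.pi * z) := by
    rw [mul_sub, mul_one, Real.sin_pi_sub]
  rw [this, mul_zero, zero_add]
  congr 2
  field_simp [Real.pi_ne_zero]

lemma continuous_hankelIntegral_hankelKernel (a : ℝ) :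
    Continuous fun z => hankelIntegral Real.pi a (hankelKernel z) := by
  simp_rw [hankelIntegral_pi]
  have h1 : Continuous fun z : ℝ =>
      ∫ y in (-Real.pi)..Real.pi, hankelKernel z (a + y * Complex.I) := by
    apply intervalIntegral.continuous_parametric_intervalIntegral_of_continuous'
    unfold hankelKernel
    fun_prop
  have h2 : Continuous fun z : ℝ =>
      ∫ u in Ioi a, Real.exp (-Real.exp u) * Real.exp (u * (1 - z)) := by
    rw [continuous_iff_continuousAt]
    intro z₀
    set m := |1 - z₀| + 1
    refine continuousAt_of_dominated
      (bound := fun u => Real.exp (-1 * Real.exp u + m * u) + Real.exp (-1 * Real.exp u + (-m) * u))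
      (Eventually.of_forall fun z => Continuous.aestronglyMeasurable (by fun_prop)) ?_
      ((integrableOn_exp_neg_mul_exp_add one_pos m a).add
        (integrableOn_exp_neg_mul_exp_add one_pos (-m) a))
      (Eventually.of_forall fun u => Continuous.continuousAt (by fun_prop))
    filter_upwards [Metric.ball_mem_nhds z₀ one_pos] with z hz
    refine Eventually.of_forall fun u => ?_
    rw [← Real.exp_add, Real.norm_of_nonneg (Real.exp_pos _).le]
    have hzm : |1 - z| ≤ m := by
      rw [Metric.mem_ball, Real.dist_eq] at hz
      calc |1 - z| = |(1 - z₀) - (z - z₀)| := by ring_nf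
        _ ≤ |1 - z₀| + |z - z₀| := abs_sub _ _
        _ ≤ m := by simp only [m]; linarith
    have hzm' := abs_le.1 hzm
    rcases le_total 0 u with hu | hu
    · refine (Real.exp_le_exp.2 ?_).trans (le_add_of_nonneg_right (Real.exp_pos _).le)
      nlinarith
    · refine (Real.exp_le_exp.2 ?_).trans (le_add_of_nonneg_left (Real.exp_pos _).le)
      nlinarith
  fun_prop

lemma hankelIntegral_pi_hankelKernel (z a : ℝ) :
    hankelIntegral Real.pi a (hankelKernel z) =
      2 * Complex.I * (Real.pi * (1 / Real.Gamma z) : ℝ) := by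
  -- The recurrence carries the factor z - 1 and says nothing about z = 1, so this value is reached
  -- by continuity from the left.
  have h1 : hankelIntegral Real.pi a (hankelKernel 1) =
      2 * Complex.I * (Real.pi * (1 / Real.Gamma 1) : ℝ) := by
    have t1 : Tendsto (fun z => hankelIntegral Real.pi a (hankelKernel z)) (𝓝[<] 1)
        (𝓝 (hankelIntegral Real.pi a (hankelKernel 1))) :=
      ((continuous_hankelIntegral_hankelKernel a).tendsto 1).mono_left nhdsWithin_le_nhds
    have hG : ContinuousAt Real.Gamma 1 :=
      (Real.differentiableAt_Gamma fun m h => by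
        linarith [(Nat.cast_nonneg m : (0 : ℝ) ≤ m)]).continuousAt
    have hc : ContinuousAt
        (fun z => 2 * Complex.I * ((Real.pi * (1 / Real.Gamma z) : ℝ) : ℂ)) 1 :=
      continuousAt_const.mul (Complex.continuous_ofReal.continuousAt.comp
        (continuousAt_const.mul (continuousAt_const.div hG (by simp))))
    have t2 := hc.tendsto.mono_left (nhdsWithin_le_nhds (s := Iio 1))
    refine tendsto_nhds_unique (t1.congr' ?_) t2
    filter_upwards [self_mem_nhdsWithin] with z hz
    exact hankelIntegral_hankelKernel_of_lt_one hz a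
  have key : ∀ n : ℕ, ∀ z : ℝ, z ≤ n + 1 → hankelIntegral Real.pi a (hankelKernel z) =
      2 * Complex.I * (Real.pi * (1 / Real.Gamma z) : ℝ) := by
    intro n
    induction n with
    | zero =>
      intro z hz
      rcases lt_or_eq_of_le (show z ≤ 1 by simpa using hz) with h | rfl
      · exact hankelIntegral_hankelKernel_of_lt_one h a
      · exact h1
    | succ n ih =>
      intro z hz
      push_cast at hz
      by_cases hzn : z ≤ n + 1
      · exact ih z hzn
      have hpos : 0 < z - 1 := by
        have : (0 : ℝ) ≤ n := n.cast_nonneg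
        linarith
      have h := ih (z - 1) (by linarith)
      rw [hankelIntegral_hankelKernel_sub_one (by simp)] at h
      have hG := Real.Gamma_add_one hpos.ne'
      rw [sub_add_cancel] at hG
      have hne : ((z - 1 : ℝ) : ℂ) ≠ 0 := Complex.ofReal_ne_zero.2 hpos.ne'
      apply mul_left_cancel₀ hne
      rw [h, hG]
      have hg := (Real.Gamma_pos_of_pos hpos).ne'
      rw [mul_left_comm, ← Complex.ofReal_mul]
      congr 2
      field_simp
  obtain ⟨n, hn⟩ := exists_nat_ge z
  exact key n z (by linarith)

/-- Hankel's formula for the reciprocal of the Gamma function. -/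
lemma hankelIntegral_hankelKernel {θ : ℝ} (h1 : Real.pi / 2 < θ) (h2 : θ ≤ Real.pi) (z a : ℝ) :
    hankelIntegral θ a (hankelKernel z) = 2 * Real.pi * Complex.I * (1 / Real.Gamma z : ℝ) := by
  rw [hankelIntegral_hankelKernel_angle h1 h2, hankelIntegral_pi_hankelKernel]
  push_cast
  ring

/-! ### The contour integral for the Mittag-Leffler function -/

/-- The integrand of the Hankel-type contour integral for `E_{β,γ}(z)` in the logarithmic
coordinate. -/
def mittagLefflerKernel (β γ z : ℝ) (w : ℂ) : ℂ :=
  hankelKernel γ w * (1 - z * Complex.exp (-(β * w)))⁻¹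

lemma norm_mul_exp_neg (β z u y : ℝ) :
    ‖(z : ℂ) * Complex.exp (-(β * (u + y * Complex.I)))‖ = |z| * Real.exp (-(β * u)) := by
  rw [norm_mul, Complex.norm_exp, Complex.norm_real, Real.norm_eq_abs]
  simp

lemma pow_mul_hankelKernel (β γ z : ℝ) (k : ℕ) (w : ℂ) :
    (z : ℂ) ^ k * hankelKernel (k * β + γ) w =
      ((z : ℂ) * Complex.exp (-(β * w))) ^ k * hankelKernel γ w := by
  rw [mul_pow, ← Complex.exp_nat_mul, hankelKernel, hankelKernel, mul_assoc, mul_left_comm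
    (Complex.exp _) (Complex.exp _), ← Complex.exp_add (_ * _)]
  congr 3
  push_cast
  ring_nf

lemma hasSum_mittagLefflerKernel {β γ z : ℝ} {w : ℂ}
    (h : ‖(z : ℂ) * Complex.exp (-(β * w))‖ < 1) :
    HasSum (fun k : ℕ => (z : ℂ) ^ k * hankelKernel (k * β + γ) w)
      (mittagLefflerKernel β γ z w) := by
  simp_rw [pow_mul_hankelKernel]
  rw [mittagLefflerKernel, mul_comm (hankelKernel γ w)]
  exact (hasSum_geometric_of_norm_lt_one h).mul_right _

lemma norm_pow_mul_hankelKernel_le {β γ z q : ℝ} (k : ℕ) {w : ℂ}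
    (h : ‖(z : ℂ) * Complex.exp (-(β * w))‖ ≤ q) :
    ‖(z : ℂ) ^ k * hankelKernel (k * β + γ) w‖ ≤ q ^ k * ‖hankelKernel γ w‖ := by
  rw [pow_mul_hankelKernel, norm_mul, norm_pow]
  gcongr

/-- For Re w ≥ a the kernel is a geometric series of ratio at most q < 1, uniformly along the
contour, so summation and integration commute by dominated convergence. -/
lemma hasSum_hankelIntegral {β θ : ℝ} (hβ : 0 < β) (h1 : Real.pi / 2 < θ) (h2 : θ ≤ Real.pi)
    (γ : ℝ) {z a : ℝ} (hz : |z| * Real.exp (-(β * a)) < 1) :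
    HasSum (fun k : ℕ => (z : ℂ) ^ k * hankelIntegral θ a (hankelKernel (k * β + γ)))
      (hankelIntegral θ a (mittagLefflerKernel β γ z)) := by
  set q := |z| * Real.exp (-(β * a)) with hq
  have hq0 : 0 ≤ q := by positivity
  have hle : ∀ u y : ℝ, a ≤ u → ‖(z : ℂ) * Complex.exp (-(β * (u + y * Complex.I)))‖ ≤ q := by
    intro u y hu
    rw [norm_mul_exp_neg, hq]
    gcongr
  have hgeo : ∀ c : ℝ, Summable fun k : ℕ => q ^ k * c := fun c =>
    (summable_geometric_of_lt_one hq0 hz).mul_right c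
  have hray : ∀ y : ℝ, Real.cos y < 0 →
      HasSum (fun k : ℕ => ∫ u in Ioi a, (z : ℂ) ^ k * hankelKernel (k * β + γ) (u + y * Complex.I))
        (∫ u in Ioi a, mittagLefflerKernel β γ z (u + y * Complex.I)) := by
    intro y hy
    refine hasSum_integral_of_dominated_convergence
      (fun k u => q ^ k * ‖hankelKernel γ (u + y * Complex.I)‖) (fun k => ?_) (fun k => ?_)
      (Eventually.of_forall fun u => hgeo _) ?_ ?_
    · exact (continuous_const.mul
        ((continuous_hankelKernel _).comp (by fun_prop))).aestronglyMeasurable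
    · filter_upwards [ae_restrict_mem measurableSet_Ioi] with u hu
      exact norm_pow_mul_hankelKernel_le k (hle u y (le_of_lt hu))
    · simp_rw [tsum_mul_right]
      exact (integrableOn_hankelKernel hy γ a).norm.const_mul _
    · filter_upwards [ae_restrict_mem measurableSet_Ioi] with u hu
      exact hasSum_mittagLefflerKernel ((hle u y (le_of_lt hu)).trans_lt hz)
  have hseg : HasSum
      (fun k : ℕ => ∫ y in (-θ)..θ, (z : ℂ) ^ k * hankelKernel (k * β + γ) (a + y * Complex.I))
        (∫ y in (-θ)..θ, mittagLefflerKernel β γ z (a + y * Complex.I)) := by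
    have hc : ∀ x, Continuous fun y : ℝ => hankelKernel x (a + y * Complex.I) :=
      fun x => (continuous_hankelKernel x).comp (by fun_prop)
    refine intervalIntegral.hasSum_integral_of_dominated_convergence
      (fun k y => q ^ k * ‖hankelKernel γ (a + y * Complex.I)‖) (fun k => ?_) (fun k => ?_)
      (Eventually.of_forall fun u _ => hgeo _) ?_ ?_
    · exact (continuous_const.mul (hc _)).aestronglyMeasurable
    · exact Eventually.of_forall fun y _ => norm_pow_mul_hankelKernel_le k (hle a y le_rfl)
    · simp_rw [tsum_mul_right]
      exact (continuous_const.mul (hc γ).norm).intervalIntegrable _ _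
    · exact Eventually.of_forall fun y _ =>
        hasSum_mittagLefflerKernel ((hle a y le_rfl).trans_lt hz)
  have hc := cos_neg_of_pi_div_two_lt h1 h2
  have h := (hseg.mul_left Complex.I).add
    ((hray θ hc).sub (hray (-θ) (by rwa [Real.cos_neg])))
  refine h.congr_fun ?_
  intro k
  simp only [hankelIntegral, intervalIntegral.integral_const_mul, integral_const_mul]
  ring

lemma hasSum_mittagLeffler_hankelIntegral {β θ : ℝ} (hβ : 0 < β) (h1 : Real.pi / 2 < θ)
    (h2 : θ ≤ Real.pi) (γ : ℝ) {z a : ℝ} (hz : |z| * Real.exp (-(β * a)) < 1) :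
    HasSum (fun k : ℕ => ((z ^ k / Real.Gamma (k * β + γ) : ℝ) : ℂ))
      (hankelIntegral θ a (mittagLefflerKernel β γ z) / (2 * Real.pi * Complex.I)) := by
  have h := (hasSum_hankelIntegral hβ h1 h2 γ hz).div_const (2 * Real.pi * Complex.I)
  refine h.congr_fun ?_
  intro k
  rw [hankelIntegral_hankelKernel h1 h2]
  have : (Real.pi : ℂ) ≠ 0 := Complex.ofReal_ne_zero.2 Real.pi_ne_zero
  push_cast
  field_simp

lemma exists_abs_mul_exp_neg_lt_one {β : ℝ} (hβ : 0 < β) (z : ℝ) :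
    ∃ a : ℝ, 0 ≤ a ∧ |z| * Real.exp (-(β * a)) < 1 := by
  have h : Tendsto (fun a : ℝ => |z| * Real.exp (-(β * a))) atTop (𝓝 0) := by
    simpa using (Real.tendsto_exp_neg_atTop_nhds_zero.comp
      (tendsto_id.const_mul_atTop hβ)).const_mul |z|
  exact ((eventually_ge_atTop 0).and (h.eventually_lt_const one_pos)).exists

lemma summable_mittagLeffler {β : ℝ} (hβ : 0 < β) (γ z : ℝ) :
    Summable fun k : ℕ => z ^ k / Real.Gamma (k * β + γ) := by
  obtain ⟨a, -, ha⟩ := exists_abs_mul_exp_neg_lt_one hβ z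
  exact Complex.summable_ofReal.1 (hasSum_mittagLeffler_hankelIntegral hβ
    (by linarith [Real.pi_pos]) le_rfl γ ha).summable

lemma hasSum_mittagLeffler₂ {β : ℝ} (hβ : 0 < β) (γ z : ℝ) :
    HasSum (fun k : ℕ => z ^ k / Real.Gamma (k * β + γ)) (mittagLeffler₂ β γ z) :=
  (summable_mittagLeffler hβ γ z).hasSum

lemma mittagLeffler_eq (β z : ℝ) : mittagLeffler β z = mittagLeffler₂ β 1 z := rfl

lemma mittagLeffler₂_eq_add {β : ℝ} (hβ : 0 < β) (γ z : ℝ) :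
    mittagLeffler₂ β γ z = 1 / Real.Gamma γ + z * mittagLeffler₂ β (β + γ) z := by
  have h := (summable_mittagLeffler hβ γ z).tsum_eq_zero_add
  rw [mittagLeffler₂, h, mittagLeffler₂, ← tsum_mul_left]
  congr 1
  · simp
  · congr 1 with k
    rw [pow_succ]
    push_cast
    rw [show ((k : ℝ) + 1) * β + γ = k * β + (β + γ) by ring]
    ring

/-! ### Decay along the negative half-line -/

/-- The modulus is at least the imaginary part, which on the rays Im w = ±θ is bounded away from
zero. -/
lemma le_norm_one_add_mul_exp {β θ y : ℝ} (hy : |y| = θ) {x : ℝ} (hx : 0 < x)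
    (hs : 0 < Real.sin (β * θ)) (u : ℝ) :
    x * Real.exp (-(β * u)) * Real.sin (β * θ) ≤
      ‖1 - ((-x : ℝ) : ℂ) * Complex.exp (-(β * (u + y * Complex.I)))‖ := by
  have him : (1 - ((-x : ℝ) : ℂ) * Complex.exp (-(β * (u + y * Complex.I)))).im =
      - (x * Real.exp (-(β * u)) * Real.sin (β * y)) := by
    rw [Complex.sub_im, Complex.im_ofReal_mul,
      Complex.exp_im]
    simp
    ring
  have habs : |Real.sin (β * y)| = Real.sin (β * θ) := by
    rcases abs_choice y with h | h
    · have : y = θ := by linarith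
      rw [this, abs_of_pos hs]
    · have : y = -θ := by linarith
      rw [this, mul_neg, Real.sin_neg, abs_neg, abs_of_pos hs]
  calc _ = |(1 - ((-x : ℝ) : ℂ) * Complex.exp (-(β * (u + y * Complex.I)))).im| := by
        rw [him, abs_neg, abs_mul, habs, abs_of_pos (by positivity)]
    _ ≤ _ := Complex.abs_im_le_norm _

lemma norm_mittagLefflerKernel_le {β θ y : ℝ} (hy : |y| = θ) {x : ℝ} (hx : 0 < x)
    (hs : 0 < Real.sin (β * θ)) (γ u : ℝ) :
    ‖mittagLefflerKernel β γ (-x) (u + y * Complex.I)‖ ≤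
      ‖hankelKernel (γ - β) (u + y * Complex.I)‖ * (x * Real.sin (β * θ))⁻¹ := by
  have h := le_norm_one_add_mul_exp hy hx hs u
  have he : ‖hankelKernel (γ - β) (u + y * Complex.I)‖ =
      ‖hankelKernel γ (u + y * Complex.I)‖ * Real.exp (β * u) := by
    rw [norm_hankelKernel, norm_hankelKernel, ← Real.exp_add]
    congr 1; ring
  rw [mittagLefflerKernel, norm_mul, norm_inv, he, mul_assoc]
  gcongr
  refine (inv_anti₀ (by positivity) h).trans (le_of_eq ?_)
  rw [Real.exp_neg]
  field_simp

/-- A zero would need e^(-βw) to be a negative real, which is impossible when |β Im w| < π. -/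
lemma one_add_mul_exp_ne_zero {β θ : ℝ} (hβ : 0 < β) (hθ : β * θ < Real.pi) {x : ℝ} (hx : 0 < x)
    {w : ℂ} (hw : w.im ∈ Icc (-θ) θ) : 1 - ((-x : ℝ) : ℂ) * Complex.exp (-(β * w)) ≠ 0 := by
  intro h
  have him := congrArg Complex.im h
  have hre := congrArg Complex.re h
  simp only [Complex.sub_im, Complex.sub_re, Complex.im_ofReal_mul, Complex.re_ofReal_mul,
    Complex.exp_im, Complex.exp_re, Complex.neg_re, Complex.neg_im, Complex.one_re,
    Complex.one_im, Complex.zero_re, Complex.zero_im] at him hre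
  have hsin : Real.sin (-(β * w.im)) = 0 := by
    have : x * Real.exp (-(β * w.re)) ≠ 0 := by positivity
    apply mul_left_cancel₀ this
    linarith
  have h0 : -(β * w.im) = 0 := by
    rw [Real.sin_eq_zero_iff_of_lt_of_lt] at hsin
    · exact hsin
    · nlinarith [hw.2]
    · nlinarith [hw.1]
  rw [h0, Real.cos_zero] at hre
  have : 0 < x * Real.exp (-(β * w.re)) := by positivity
  linarith

lemma differentiableAt_mittagLefflerKernel {β γ z : ℝ} {w : ℂ}
    (h : 1 - (z : ℂ) * Complex.exp (-(β * w)) ≠ 0) :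
    DifferentiableAt ℂ (mittagLefflerKernel β γ z) w := by
  unfold mittagLefflerKernel
  refine ((differentiable_hankelKernel γ) w).mul (DifferentiableAt.inv (by fun_prop) h)

lemma integrableOn_mittagLefflerKernel {β θ y : ℝ} (hβ : 0 < β) (hθ : β * θ < Real.pi)
    (hθ0 : 0 < θ) (hy : |y| = θ) (hc : Real.cos y < 0) {x : ℝ} (hx : 0 < x) (γ a : ℝ) :
    IntegrableOn (fun u : ℝ => mittagLefflerKernel β γ (-x) (u + y * Complex.I)) (Ioi a) := by
  have hs : 0 < Real.sin (β * θ) := Real.sin_pos_of_pos_of_lt_pi (by positivity) hθ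
  refine Integrable.mono' ((integrableOn_hankelKernel hc (γ - β) a).norm.mul_const
    (x * Real.sin (β * θ))⁻¹) ?_
    (Eventually.of_forall fun u => norm_mittagLefflerKernel_le hy hx hs γ u)
  refine Continuous.aestronglyMeasurable (continuous_iff_continuousAt.2 fun u => ?_)
  have hd := differentiableAt_mittagLefflerKernel (γ := γ) (one_add_mul_exp_ne_zero hβ hθ hx
    (w := u + y * Complex.I) (by simpa using abs_le.1 hy.le))
  exact ContinuousAt.comp (f := fun u : ℝ => (u : ℂ) + y * Complex.I)
    hd.continuousAt (by fun_prop)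

/-- The series needs a contour far to the right, depending on x. With no pole in the strip, it
slides back to Re w = 0, a contour independent of x. -/
lemma mittagLeffler₂_neg_eq {β θ : ℝ} (hβ : 0 < β) (h1 : Real.pi / 2 < θ) (h2 : θ ≤ Real.pi)
    (h3 : β * θ < Real.pi) (γ : ℝ) {x : ℝ} (hx : 0 < x) :
    (mittagLeffler₂ β γ (-x) : ℂ) =
      hankelIntegral θ 0 (mittagLefflerKernel β γ (-x)) / (2 * Real.pi * Complex.I) := by
  obtain ⟨a, ha0, ha⟩ := exists_abs_mul_exp_neg_lt_one hβ (-x)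
  have hθ : 0 < θ := by linarith [Real.pi_pos]
  have hc := cos_neg_of_pi_div_two_lt h1 h2
  rw [hankelIntegral_shift hθ.le ha0
    (fun w _ hw => differentiableAt_mittagLefflerKernel (one_add_mul_exp_ne_zero hβ h3 hx hw))
    (integrableOn_mittagLefflerKernel hβ h3 hθ (abs_of_pos hθ) hc hx γ 0)
    (integrableOn_mittagLefflerKernel hβ h3 hθ (by rw [abs_neg, abs_of_pos hθ])
      (by rwa [Real.cos_neg]) hx γ 0)]
  exact (Complex.hasSum_ofReal.2 (hasSum_mittagLeffler₂ hβ γ (-x))).unique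
    (hasSum_mittagLeffler_hankelIntegral hβ h1 h2 γ ha)

lemma norm_mittagLefflerKernel_zero_le {β γ x y : ℝ} (hx : 2 ≤ x) :
    ‖mittagLefflerKernel β γ (-x) (((0 : ℝ) : ℂ) + y * Complex.I)‖ ≤ Real.exp 1 * 2 * x⁻¹ := by
  have h1 : ‖hankelKernel γ (((0 : ℝ) : ℂ) + y * Complex.I)‖ ≤ Real.exp 1 := by
    rw [norm_hankelKernel]
    apply Real.exp_le_exp.2
    simpa using Real.cos_le_one y
  have h2 : x / 2 ≤
      ‖1 - ((-x : ℝ) : ℂ) * Complex.exp (-(β * (((0 : ℝ) : ℂ) + y * Complex.I)))‖ := by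
    have := norm_sub_norm_le (((-x : ℝ) : ℂ) *
      Complex.exp (-(β * (((0 : ℝ) : ℂ) + y * Complex.I)))) 1
    rw [norm_mul_exp_neg, norm_sub_rev, abs_neg, abs_of_pos (by linarith)] at this
    simp only [mul_zero, neg_zero, Real.exp_zero, mul_one, norm_one] at this
    linarith
  rw [mittagLefflerKernel, norm_mul, norm_inv, mul_assoc]
  have h3 : 2 * x⁻¹ = (x / 2)⁻¹ := by field_simp
  rw [h3]
  gcongr

/-- Decay of `E_{β,γ}` along the negative half-line, for `1 < β < 2`. -/
lemma isBigO_mittagLeffler₂_neg {β : ℝ} (hβ₀ : 1 < β) (hβ : β < 2) (γ : ℝ) :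
    (fun x => mittagLeffler₂ β γ (-x)) =O[atTop] fun x => x⁻¹ := by
  have hp := Real.pi_pos
  -- θ > π/2 makes the rays converge and θ < π/β keeps the poles outside; such θ exists exactly
  -- because β < 2.
  obtain ⟨θ, h1, h3⟩ : ∃ θ, Real.pi / 2 < θ ∧ θ < Real.pi / β :=
    exists_between (by gcongr)
  have hb : 0 < β := by linarith
  have h2 : θ ≤ Real.pi := h3.le.trans (div_le_self hp.le hβ₀.le)
  have h3 : β * θ < Real.pi := by rwa [lt_div_iff₀' hb] at h3
  have hθ : 0 < θ := by linarith
  have hs : 0 < Real.sin (β * θ) := Real.sin_pos_of_pos_of_lt_pi (by positivity) h3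
  have hc := cos_neg_of_pi_div_two_lt h1 h2
  have hc' : Real.cos (-θ) < 0 := by rwa [Real.cos_neg]
  set R : ℝ → ℝ := fun y => ∫ u in Ioi (0 : ℝ), ‖hankelKernel (γ - β) (u + y * Complex.I)‖ with hR
  have hray : ∀ y : ℝ, |y| = θ → Real.cos y < 0 → ∀ x, 0 < x →
      ‖∫ u in Ioi (0 : ℝ), mittagLefflerKernel β γ (-x) (u + y * Complex.I)‖ ≤
        R y * (Real.sin (β * θ))⁻¹ * x⁻¹ := by
    intro y hy hcy x hx
    have hi := (integrableOn_hankelKernel hcy (γ - β) 0).norm.mul_const (x * Real.sin (β * θ))⁻¹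
    refine (norm_integral_le_of_norm_le hi
      (Eventually.of_forall fun u => norm_mittagLefflerKernel_le hy hx hs γ u)).trans (le_of_eq ?_)
    rw [integral_mul_const, mul_inv]
    ring
  refine Asymptotics.IsBigO.of_bound ((Real.exp 1 * 2 * |θ - -θ| + (R θ * (Real.sin (β * θ))⁻¹ +
    R (-θ) * (Real.sin (β * θ))⁻¹)) / (2 * Real.pi)) ?_
  filter_upwards [eventually_ge_atTop 2] with x hx
  have hx0 : 0 < x := by linarith
  have hseg : ‖∫ y in (-θ)..θ, mittagLefflerKernel β γ (-x) (((0 : ℝ) : ℂ) + y * Complex.I)‖ ≤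
      Real.exp 1 * 2 * x⁻¹ * |θ - -θ| :=
    intervalIntegral.norm_integral_le_of_norm_le_const fun y _ =>
      norm_mittagLefflerKernel_zero_le hx
  have hH : ‖hankelIntegral θ 0 (mittagLefflerKernel β γ (-x))‖ ≤
      Real.exp 1 * 2 * x⁻¹ * |θ - -θ| + (R θ * (Real.sin (β * θ))⁻¹ * x⁻¹ +
        R (-θ) * (Real.sin (β * θ))⁻¹ * x⁻¹) := by
    rw [hankelIntegral]
    refine (norm_add_le _ _).trans (add_le_add ?_ ((norm_sub_le _ _).trans (add_le_add ?_ ?_)))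
    · rw [norm_mul, Complex.norm_I, one_mul]
      exact hseg
    · exact hray θ (abs_of_pos hθ) hc x hx0
    · exact hray (-θ) (by rw [abs_neg, abs_of_pos hθ]) hc' x hx0
  have hn : ‖mittagLeffler₂ β γ (-x)‖ = ‖(mittagLeffler₂ β γ (-x) : ℂ)‖ :=
    (Complex.norm_real _).symm
  rw [hn, mittagLeffler₂_neg_eq hb h1 h2 h3 γ hx0, norm_div, norm_inv,
    Real.norm_of_nonneg hx0.le]
  have hd : ‖(2 * Real.pi * Complex.I : ℂ)‖ = 2 * Real.pi := by
    simp [abs_of_pos hp]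
  rw [hd, div_mul_eq_mul_div]
  gcongr
  refine hH.trans (le_of_eq ?_)
  ring

/-- The leading term of `E_{β,γ}` along the negative half-line. -/
lemma tendsto_mul_mittagLeffler₂_neg {β : ℝ} (hβ₀ : 1 < β) (hβ : β < 2) (γ : ℝ) :
    Tendsto (fun x => x * mittagLeffler₂ β γ (-x)) atTop (𝓝 (1 / Real.Gamma (γ - β))) := by
  -- Decay is used at the lowered index γ - β; the recurrence then isolates x E_{β,γ}(-x).
  have h0 : Tendsto (fun x => mittagLeffler₂ β (γ - β) (-x)) atTop (𝓝 0) :=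
    (isBigO_mittagLeffler₂_neg hβ₀ hβ (γ - β)).trans_tendsto tendsto_inv_atTop_zero
  have := h0.const_sub (1 / Real.Gamma (γ - β))
  rw [sub_zero] at this
  refine this.congr fun x => ?_
  rw [mittagLeffler₂_eq_add (by linarith) (γ - β), add_sub_cancel]
  ring

/-! ### Derivatives of Mittag-Leffler functions -/

lemma sub_one_div_Gamma (s : ℝ) : (s - 1) / Real.Gamma s = 1 / Real.Gamma (s - 1) := by
  by_cases h : s - 1 = 0
  · rw [h, Real.Gamma_zero]; simp
  · have := Real.Gamma_add_one h
    rw [sub_add_cancel] at this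
    rw [this, div_mul_cancel_left₀ h, one_div]

lemma hasDerivAt_mittagLeffler₂ {β : ℝ} (hβ : 0 < β) (γ z : ℝ) :
    HasDerivAt (mittagLeffler₂ β γ)
      (∑' k : ℕ, (k * z ^ (k - 1)) / Real.Gamma (k * β + γ)) z := by
  set R := |z| + 1 with hR
  have hR1 : 1 ≤ R := by simp [hR]
  -- Since k < 2^k, the differentiated terms on the ball of radius R are dominated by the original
  -- series at 2R.
  have hs : Summable fun k : ℕ => |(2 * R) ^ k / Real.Gamma (k * β + γ)| :=
    (summable_mittagLeffler hβ γ (2 * R)).abs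
  refine hasDerivAt_tsum_of_isPreconnected (g := fun (k : ℕ) z => z ^ k / Real.Gamma (k * β + γ))
    (g' := fun (k : ℕ) z => (k * z ^ (k - 1)) / Real.Gamma (k * β + γ))
    (u := fun k : ℕ => |(2 * R) ^ k / Real.Gamma (k * β + γ)|) (t := Metric.ball 0 R) (y₀ := 0) hs
    Metric.isOpen_ball (convex_ball _ _).isPreconnected
    (fun k y _ => (hasDerivAt_pow k y).div_const _) (fun k y hy => ?_)
    (Metric.mem_ball_self (by linarith)) (summable_mittagLeffler hβ γ 0) (by simp [hR])
  have hyR : |y| ≤ R := by simpa using (Metric.mem_ball.1 hy).le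
  rw [norm_div, abs_div, Real.norm_eq_abs, Real.norm_eq_abs, abs_mul, abs_pow, mul_pow, abs_mul,
    abs_of_pos (by positivity : (0 : ℝ) < 2 ^ k), abs_of_pos (by positivity : (0 : ℝ) < R ^ k),
    Nat.abs_cast]
  gcongr
  · exact_mod_cast k.lt_two_pow_self.le
  · calc |y| ^ (k - 1) ≤ R ^ (k - 1) := by gcongr
      _ ≤ R ^ k := pow_le_pow_right₀ hR1 (Nat.sub_le _ _)

lemma continuous_mittagLeffler₂ {β : ℝ} (hβ : 0 < β) (γ : ℝ) :
    Continuous (mittagLeffler₂ β γ) :=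
  continuous_iff_continuousAt.2 fun z => (hasDerivAt_mittagLeffler₂ hβ γ z).continuousAt

/-- Termwise this is (s - 1)/Γ(s) = 1/Γ(s - 1) with s = kβ + γ. -/
lemma mul_deriv_mittagLeffler₂_add {β : ℝ} (hβ : 0 < β) (γ z : ℝ) :
    β * z * deriv (mittagLeffler₂ β γ) z + (γ - 1) * mittagLeffler₂ β γ z =
      mittagLeffler₂ β (γ - 1) z := by
  have h1 := hasSum_mittagLeffler₂ hβ γ z
  have h2 := hasSum_mittagLeffler₂ hβ (γ - 1) z
  have h3 := h2.sub (h1.mul_left (γ - 1))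
  have h4 : ∀ k : ℕ, z ^ k / Real.Gamma (k * β + (γ - 1)) -
      (γ - 1) * (z ^ k / Real.Gamma (k * β + γ)) =
      β * z * ((k * z ^ (k - 1)) / Real.Gamma (k * β + γ)) := by
    intro k
    have h := sub_one_div_Gamma (k * β + γ)
    rw [← add_sub_assoc, div_eq_mul_one_div, ← h]
    rcases k with _ | k
    · simp; ring
    · simp only [Nat.add_sub_cancel, pow_succ]
      ring
  simp_rw [h4] at h3
  rw [(hasDerivAt_mittagLeffler₂ hβ γ z).deriv, ← tsum_mul_left, h3.tsum_eq]
  ring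

/-- The function `t ↦ t ^ (γ - 1) E_{β,γ}(r t ^ β)`. -/
def mittagLefflerPower (β r γ t : ℝ) : ℝ := t ^ (γ - 1) * mittagLeffler₂ β γ (r * t ^ β)

lemma hasDerivAt_mittagLefflerPower {β : ℝ} (hβ : 0 < β) (r γ : ℝ) {t : ℝ} (ht : 0 < t) :
    HasDerivAt (mittagLefflerPower β r γ) (mittagLefflerPower β r (γ - 1) t) t := by
  have h1 := Real.hasDerivAt_rpow_const (p := γ - 1) (Or.inl ht.ne')
  have h2 := (Real.hasDerivAt_rpow_const (p := β) (Or.inl ht.ne')).const_mul r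
  have h3 := (hasDerivAt_mittagLeffler₂ hβ γ (r * t ^ β)).differentiableAt.hasDerivAt
  refine (h1.mul (h3.comp t h2)).congr_deriv ?_
  rw [mittagLefflerPower, ← mul_deriv_mittagLeffler₂_add hβ γ, Function.comp_apply]
  have e1 : t ^ (γ - 1) = t ^ (γ - 1 - 1) * t := by
    rw [← Real.rpow_add_one ht.ne']; ring_nf
  have e2 : t * t ^ (β - 1) = t ^ β := by
    rw [mul_comm, ← Real.rpow_add_one ht.ne']; ring_nf
  rw [e1]
  linear_combination (t ^ (γ - 1 - 1) * deriv (mittagLeffler₂ β γ) (r * t ^ β) * r * β) * e2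

lemma mittagLefflerPower_eq_add {β : ℝ} (hβ : 0 < β) (r γ : ℝ) {t : ℝ} (ht : 0 < t) :
    mittagLefflerPower β r γ t =
      t ^ (γ - 1) / Real.Gamma γ + r * mittagLefflerPower β r (β + γ) t := by
  have : t ^ (β + γ - 1) = t ^ (γ - 1) * t ^ β := by
    rw [← Real.rpow_add ht]; ring_nf
  rw [mittagLefflerPower, mittagLefflerPower, mittagLeffler₂_eq_add hβ, this]
  ring

lemma contDiffOn_mittagLefflerPower {β : ℝ} (hβ : 0 < β) (r : ℝ) (n : ℕ) (γ : ℝ) :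
    ContDiffOn ℝ n (mittagLefflerPower β r γ) (Ioi 0) := by
  induction n generalizing γ with
  | zero =>
    exact contDiffOn_zero.2 fun t ht =>
      (hasDerivAt_mittagLefflerPower hβ r γ ht).continuousAt.continuousWithinAt
  | succ n ih =>
    refine (contDiffOn_succ_iff_deriv_of_isOpen (n := (n : WithTop ℕ∞)) isOpen_Ioi).2 ⟨fun t ht =>
      (hasDerivAt_mittagLefflerPower hβ r γ ht).differentiableAt.differentiableWithinAt,
      by simp, ?_⟩
    exact (ih (γ - 1)).congr fun t ht => (hasDerivAt_mittagLefflerPower hβ r γ ht).deriv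

/-! ### Beta integrals and fractional integration -/

lemma integral_beta {p q t : ℝ} (hp : 0 < p) (hq : 0 < q) (ht : 0 < t) :
    ∫ τ in 0..t, (t - τ) ^ (p - 1) * τ ^ (q - 1) =
      Real.Gamma p * Real.Gamma q / Real.Gamma (q + p) * t ^ (q + p - 1) := by
  have h := Complex.betaIntegral_scaled q p ht
  have hG := Complex.Gamma_mul_Gamma_eq_betaIntegral (s := q) (t := p) (by simpa) (by simpa)
  have hne : Real.Gamma (q + p) ≠ 0 := (Real.Gamma_pos_of_pos (by linarith)).ne'
  rw [← Complex.ofReal_add, Complex.Gamma_ofReal, Complex.Gamma_ofReal, Complex.Gamma_ofReal] at hG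
  have hb : Complex.betaIntegral q p =
      ((Real.Gamma p * Real.Gamma q / Real.Gamma (q + p) : ℝ) : ℂ) := by
    have : ((Real.Gamma (q + p) : ℝ) : ℂ) ≠ 0 := Complex.ofReal_ne_zero.2 hne
    push_cast
    rw [eq_div_iff this, mul_comm, ← hG, mul_comm]
  apply Complex.ofReal_injective
  rw [← intervalIntegral.integral_ofReal, Complex.ofReal_mul, ← hb, Complex.ofReal_cpow ht.le,
    mul_comm]
  push_cast
  rw [← h]
  refine intervalIntegral.integral_congr fun τ hτ => ?_
  rw [uIcc_of_le ht.le] at hτ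
  rw [Complex.ofReal_cpow (by linarith [hτ.2]), Complex.ofReal_cpow hτ.1]
  push_cast
  ring

/-- A non-integrable function has integral 0 by convention, whereas the Beta value is positive. -/
lemma intervalIntegrable_beta {p q t : ℝ} (hp : 0 < p) (hq : 0 < q) (ht : 0 < t) :
    IntervalIntegrable (fun τ => (t - τ) ^ (p - 1) * τ ^ (q - 1)) volume 0 t := by
  by_contra h
  have h1 := integral_beta hp hq ht
  rw [intervalIntegral.integral_undef h] at h1
  have h2 := Real.Gamma_pos_of_pos hp
  have h3 := Real.Gamma_pos_of_pos hq
  have h4 := Real.Gamma_pos_of_pos (add_pos hq hp)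
  have : 0 < Real.Gamma p * Real.Gamma q / Real.Gamma (q + p) * t ^ (q + p - 1) := by positivity
  linarith

lemma intervalIntegrable_rpow_mul_mittagLefflerPower {β p γ t : ℝ} (hβ : 0 < β) (r : ℝ)
    (hp : 0 < p) (hγ : 0 < γ) (ht : 0 < t) :
    IntervalIntegrable (fun τ => (t - τ) ^ (p - 1) * mittagLefflerPower β r γ τ) volume 0 t := by
  have h := (intervalIntegrable_beta hp hγ ht).mul_continuousOn
    (g := fun τ => mittagLeffler₂ β γ (r * τ ^ β))
    (((continuous_mittagLeffler₂ hβ γ).comp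
      (continuous_const.mul (Real.continuous_rpow_const hβ.le))).continuousOn)
  refine h.congr fun τ _ => ?_
  simp only [mittagLefflerPower]
  ring

/-- Fractional integration of order `p` raises the second parameter by `p`. -/
lemma integral_rpow_mul_mittagLefflerPower {β p γ t : ℝ} (hβ : 0 < β) (r : ℝ)
    (hp : 0 < p) (hγ : 0 < γ) (ht : 0 < t) :
    ∫ τ in 0..t, (t - τ) ^ (p - 1) * mittagLefflerPower β r γ τ =
      Real.Gamma p * mittagLefflerPower β r (γ + p) t := by
  have hkγ : ∀ k : ℕ, 0 < k * β + γ := fun k => by positivity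
  have hterm : ∀ (s : ℝ) (k : ℕ), ∫ τ in 0..t,
      s ^ k / Real.Gamma (k * β + γ) * ((t - τ) ^ (p - 1) * τ ^ (k * β + γ - 1)) =
      Real.Gamma p * t ^ (γ + p - 1) *
        ((s * t ^ β) ^ k / Real.Gamma (k * β + (γ + p))) := by
    intro s k
    rw [intervalIntegral.integral_const_mul, integral_beta hp (hkγ k) ht]
    have e1 : t ^ (k * β + γ + p - 1) = t ^ (γ + p - 1) * (t ^ β) ^ k := by
      rw [← Real.rpow_natCast, ← Real.rpow_mul ht.le, ← Real.rpow_add ht]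
      ring_nf
    have := (Real.Gamma_pos_of_pos (hkγ k)).ne'
    rw [e1, add_assoc, mul_pow]
    field_simp
  have hF : ∀ (s : ℝ) (k : ℕ), IntervalIntegrable (fun τ =>
      s ^ k / Real.Gamma (k * β + γ) * ((t - τ) ^ (p - 1) * τ ^ (k * β + γ - 1))) volume 0 t :=
    fun s k => (intervalIntegrable_beta hp (hkγ k) ht).const_mul _
  -- Stated for every s: s = |r| gives summability of the norms, s = r the value.
  have hsum := fun s => (hasSum_mittagLeffler₂ hβ (γ + p) (s * t ^ β)).mul_left
    (Real.Gamma p * t ^ (γ + p - 1))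
  simp_rw [← hterm] at hsum
  simp_rw [intervalIntegral.integral_of_le ht.le] at hsum ⊢
  have hnorm : ∀ k : ℕ, ∫ τ in Ioc 0 t,
      ‖r ^ k / Real.Gamma (k * β + γ) * ((t - τ) ^ (p - 1) * τ ^ (k * β + γ - 1))‖ =
      ∫ τ in Ioc 0 t,
        |r| ^ k / Real.Gamma (k * β + γ) * ((t - τ) ^ (p - 1) * τ ^ (k * β + γ - 1)) := by
    intro k
    refine setIntegral_congr_fun measurableSet_Ioc fun τ hτ => ?_
    have h1 : 0 ≤ (t - τ) ^ (p - 1) := Real.rpow_nonneg (by linarith [hτ.2]) _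
    have h2 : 0 ≤ τ ^ (k * β + γ - 1) := Real.rpow_nonneg hτ.1.le _
    simp only [norm_mul, norm_div, norm_pow, Real.norm_eq_abs, abs_of_nonneg h1, abs_of_nonneg h2,
      abs_of_pos (Real.Gamma_pos_of_pos (hkγ k))]
  have key := hasSum_integral_of_summable_integral_norm (μ := volume.restrict (Ioc 0 t))
    (F := fun (k : ℕ) τ =>
      r ^ k / Real.Gamma (k * β + γ) * ((t - τ) ^ (p - 1) * τ ^ (k * β + γ - 1)))
    (fun k => (intervalIntegrable_iff_integrableOn_Ioc_of_le ht.le).1 (hF r k))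
    (by simp_rw [hnorm]; exact (hsum |r|).summable)
  have e := key.unique (hsum r)
  rw [mittagLefflerPower, ← mul_assoc, ← e]
  refine setIntegral_congr_fun measurableSet_Ioc fun τ hτ => ?_
  rw [mittagLefflerPower, mittagLeffler₂, ← mul_assoc, ← tsum_mul_left]
  congr 1 with k
  have e1 : τ ^ (k * β + γ - 1) = τ ^ (γ - 1) * (τ ^ β) ^ k := by
    rw [← Real.rpow_natCast, ← Real.rpow_mul hτ.1.le, ← Real.rpow_add hτ.1]
    ring_nf
  rw [e1, mul_pow]
  ring

lemma integral_beta_shift {p q s T : ℝ} (hp : 0 < p) (hq : 0 < q) (hs : s < T) :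
    ∫ τ in s..T, (T - τ) ^ (p - 1) * (τ - s) ^ (q - 1) =
      Real.Gamma p * Real.Gamma q / Real.Gamma (q + p) * (T - s) ^ (q + p - 1) := by
  rw [← integral_beta hp hq (sub_pos.2 hs)]
  have := intervalIntegral.integral_comp_sub_right
    (fun x => (T - s - x) ^ (p - 1) * x ^ (q - 1)) (a := s) (b := T) s
  rw [sub_self] at this
  rw [← this]
  simp only [sub_sub_sub_cancel_right]

lemma intervalIntegrable_beta_shift {p q s T : ℝ} (hp : 0 < p) (hq : 0 < q) (hs : s < T) :
    IntervalIntegrable (fun τ => (T - τ) ^ (p - 1) * (τ - s) ^ (q - 1)) volume s T := by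
  apply intervalIntegral.intervalIntegrable_of_integral_ne_zero
  rw [integral_beta_shift hp hq hs]
  have h2 := Real.Gamma_pos_of_pos hp
  have h3 := Real.Gamma_pos_of_pos hq
  have h4 := Real.Gamma_pos_of_pos (add_pos hq hp)
  have h5 := Real.rpow_pos_of_pos (sub_pos.2 hs) (q + p - 1)
  positivity

/-- The semigroup property of fractional integration. -/
lemma integral_rpow_mul_integral_rpow_mul {p q T : ℝ} (hp : 0 < p) (hq : 0 < q)
    (hpq : 1 ≤ q + p) (hT : 0 < T) {g : ℝ → ℝ} (hg : IntervalIntegrable g volume 0 T) :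
    ∫ τ in 0..T, (T - τ) ^ (p - 1) * (∫ s in 0..τ, (τ - s) ^ (q - 1) * g s) =
      Real.Gamma p * Real.Gamma q / Real.Gamma (q + p) *
        ∫ s in 0..T, (T - s) ^ (q + p - 1) * g s := by
  set B := Real.Gamma p * Real.Gamma q / Real.Gamma (q + p)
  set μ := volume.restrict (Ioo 0 T)
  -- Extending by zero off the triangle s < τ lets Fubini be applied on the square.
  set f : ℝ → ℝ → ℝ := fun τ s =>
    if s < τ then (T - τ) ^ (p - 1) * (τ - s) ^ (q - 1) * g s else 0 with hf
  have hgi : Integrable g μ := by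
    rw [intervalIntegrable_iff_integrableOn_Ioo_of_le hT.le] at hg
    exact hg
  have hfs : ∀ τ, (fun s => f τ s) =
      (Iio τ).indicator fun s => (T - τ) ^ (p - 1) * (τ - s) ^ (q - 1) * g s := by
    intro τ; ext s; simp [hf, indicator_apply]
  have hfτ : ∀ s, (fun τ => f τ s) =
      (Ioi s).indicator fun τ => (T - τ) ^ (p - 1) * (τ - s) ^ (q - 1) * g s := by
    intro s; ext τ; simp [hf, indicator_apply]
  have hinter1 : ∀ τ ∈ Ioo 0 T, Ioo 0 T ∩ Iio τ = Ioo 0 τ := by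
    intro τ hτ; ext s
    simp only [mem_inter_iff, mem_Ioo, mem_Iio]
    exact ⟨fun h => ⟨h.1.1, h.2⟩, fun h => ⟨⟨h.1, h.2.trans hτ.2⟩, h.2⟩⟩
  have hinter2 : ∀ s ∈ Ioo 0 T, Ioo 0 T ∩ Ioi s = Ioo s T := by
    intro s hs; ext τ
    simp only [mem_inter_iff, mem_Ioo, mem_Ioi]
    exact ⟨fun h => ⟨h.2, h.1.2⟩, fun h => ⟨⟨hs.1.trans h.1, h.2⟩, h.1⟩⟩
  have hL : ∀ τ ∈ Ioo 0 T, ∫ s, f τ s ∂μ =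
      (T - τ) ^ (p - 1) * (∫ s in 0..τ, (τ - s) ^ (q - 1) * g s) := by
    intro τ hτ
    rw [hfs, setIntegral_indicator measurableSet_Iio, hinter1 τ hτ, ← integral_Ioc_eq_integral_Ioo,
      ← intervalIntegral.integral_of_le hτ.1.le, ← intervalIntegral.integral_const_mul]
    simp_rw [mul_assoc]
  have hbeta : ∀ s ∈ Ioo 0 T, ∀ c : ℝ,
      ∫ τ in Ioo s T, (T - τ) ^ (p - 1) * (τ - s) ^ (q - 1) * c =
        B * ((T - s) ^ (q + p - 1) * c) := by
    intro s hs c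
    rw [← integral_Ioc_eq_integral_Ioo, ← intervalIntegral.integral_of_le hs.2.le,
      intervalIntegral.integral_mul_const, integral_beta_shift hp hq hs.2]
    ring
  have hR : ∀ s ∈ Ioo 0 T, ∫ τ, f τ s ∂μ = B * ((T - s) ^ (q + p - 1) * g s) := by
    intro s hs
    rw [hfτ, setIntegral_indicator measurableSet_Ioi, hinter2 s hs, hbeta s hs]
  have hint : Integrable (Function.uncurry f) (μ.prod μ) := by
    rw [integrable_prod_iff']
    · constructor
      · filter_upwards [ae_restrict_mem measurableSet_Ioo] with s hs
        simp only [Function.uncurry_apply_pair]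
        rw [hfτ, integrable_indicator_iff measurableSet_Ioi, IntegrableOn,
          Measure.restrict_restrict measurableSet_Ioi, inter_comm, hinter2 s hs]
        exact ((intervalIntegrable_iff_integrableOn_Ioo_of_le hs.2.le).1
          (intervalIntegrable_beta_shift hp hq hs.2)).mul_const _
      -- The norm integrated in τ is again a Beta integral; q + p ≥ 1 makes the remaining power of T
      -- - s continuous.
      · have h1 : IntervalIntegrable (fun s => B * ((T - s) ^ (q + p - 1) * |g s|)) volume 0 T := by
          refine (IntervalIntegrable.continuousOn_mul hg.abs ?_).const_mul _
          exact ((Real.continuous_rpow_const (by linarith)).comp (by fun_prop)).continuousOn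
        rw [intervalIntegrable_iff_integrableOn_Ioo_of_le hT.le] at h1
        refine Integrable.congr h1 ?_
        filter_upwards [ae_restrict_mem measurableSet_Ioo] with s hs
        rw [← hbeta s hs, ← hinter2 s hs, ← setIntegral_indicator measurableSet_Ioi]
        refine setIntegral_congr_fun measurableSet_Ioo fun τ hτ => ?_
        simp only [Function.uncurry_apply_pair, hf, indicator_apply, mem_Ioi]
        split_ifs with h
        · rw [norm_mul, norm_mul, Real.norm_eq_abs, Real.norm_eq_abs, Real.norm_eq_abs,
            abs_of_nonneg (Real.rpow_nonneg (by linarith [hτ.2]) _),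
            abs_of_nonneg (Real.rpow_nonneg (by linarith) _)]
        · simp
    · have hm : AEStronglyMeasurable
          (fun x : ℝ × ℝ => (T - x.1) ^ (p - 1) * (x.1 - x.2) ^ (q - 1) * g x.2) (μ.prod μ) := by
        refine AEStronglyMeasurable.mul (Measurable.aestronglyMeasurable (by fun_prop)) ?_
        exact hgi.aestronglyMeasurable.comp_snd
      have hset : MeasurableSet {x : ℝ × ℝ | x.2 < x.1} :=
        measurableSet_lt measurable_snd measurable_fst
      refine (hm.indicator hset).congr (Eventually.of_forall fun x => ?_)
      simp [hf, indicator_apply, Function.uncurry]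
  have hswap := integral_integral_swap hint
  rw [setIntegral_congr_fun measurableSet_Ioo hL, setIntegral_congr_fun measurableSet_Ioo hR] at hswap
  rw [intervalIntegral.integral_of_le hT.le, intervalIntegral.integral_of_le hT.le,
    integral_Ioc_eq_integral_Ioo, integral_Ioc_eq_integral_Ioo, hswap, integral_const_mul]

/-- A continuous function satisfying a homogeneous Volterra equation with bounded kernel
vanishes. -/
lemma eq_zero_of_abs_le_integral {w : ℝ → ℝ} (hw : ContinuousOn w (Ici 0)) {K T : ℝ}
    (hK : ∀ t ∈ Icc 0 T, |w t| ≤ K * ∫ s in 0..t, |w s|) : ∀ t ∈ Icc 0 T, w t = 0 := by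
  -- A continuous extension to the whole line, so that its primitive is differentiable at 0 too;
  -- Grönwall is applied to that primitive.
  set h : ℝ → ℝ := fun t => |w (max t 0)| with hh
  have hc : Continuous h :=
    (hw.comp_continuous (by fun_prop : Continuous fun t : ℝ => max t 0)
      (fun t => le_max_right t 0)).abs
  have hwh : ∀ t, 0 ≤ t → h t = |w t| := fun t ht => by simp only [hh, max_eq_left ht]
  have hint : ∀ t, 0 ≤ t → ∫ s in 0..t, h s = ∫ s in 0..t, |w s| := fun t ht =>
    intervalIntegral.integral_congr fun s hs => hwh s (by rw [uIcc_of_le ht] at hs; exact hs.1)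
  have hder : ∀ t, HasDerivAt (fun t => ∫ s in 0..t, h s) (h t) t := fun t =>
    (hc.integral_hasStrictDerivAt 0 t).hasDerivAt
  have hz := eq_zero_of_abs_deriv_le_mul_abs_self_of_eq_zero_right (a := 0) (b := T) (K := |K|)
    (f := fun t => ∫ s in 0..t, h s) (f' := h)
    (fun t _ => (hder t).continuousAt.continuousWithinAt) (fun t _ => (hder t).hasDerivWithinAt)
    intervalIntegral.integral_same (fun t ht => by
      rw [hwh t ht.1, hint t ht.1, Real.norm_eq_abs, abs_abs, Real.norm_eq_abs, ← abs_mul]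
      exact (hK t ⟨ht.1, ht.2.le⟩).trans (le_abs_self _))
  intro t ht
  have h1 := hK t ht
  rw [← hint t ht.1, hz t ht, mul_zero] at h1
  exact abs_nonpos_iff.1 h1

/-! ### From the Caputo problem to a Volterra equation; uniqueness -/

lemma natCeil_eq_two {β : ℝ} (hβ₁ : 1 < β) (hβ₂ : β < 2) : ⌈β⌉₊ = 2 := by
  rw [Nat.ceil_eq_iff two_ne_zero]
  norm_num
  exact ⟨hβ₁, hβ₂.le⟩

lemma caputoIntegrand_eq {β : ℝ} (hβ₁ : 1 < β) (hβ₂ : β < 2) (f : ℝ → ℝ) (t τ : ℝ) :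
    caputoIntegrand β f t τ = (t - τ) ^ (2 - β - 1) * deriv (deriv f) τ := by
  rw [caputoIntegrand, natCeil_eq_two hβ₁ hβ₂, iteratedDeriv_succ, iteratedDeriv_one]
  norm_num

lemma caputoDeriv_eq {β : ℝ} (hβ₁ : 1 < β) (hβ₂ : β < 2) (f : ℝ → ℝ) (t : ℝ) :
    caputoDeriv 0 β f t =
      1 / Real.Gamma (2 - β) * ∫ τ in 0..t, (t - τ) ^ (2 - β - 1) * deriv (deriv f) τ := by
  simp_rw [caputoDeriv, caputoIntegrand_eq hβ₁ hβ₂, natCeil_eq_two hβ₁ hβ₂]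
  norm_num

section Solution

variable {β r a b : ℝ} {u : ℝ → ℝ}

lemma IsCaputoSolution.contDiffOn (hβ₁ : 1 < β) (hβ₂ : β < 2) (hu : IsCaputoSolution β r a b u) :
    ContDiffOn ℝ 2 u (Ioi 0) := by
  have := hu.caputoDifferentiable.contDiffOn
  rw [natCeil_eq_two hβ₁ hβ₂] at this
  exact this

lemma IsCaputoSolution.hasDerivAt (hβ₁ : 1 < β) (hβ₂ : β < 2) (hu : IsCaputoSolution β r a b u)
    {t : ℝ} (ht : 0 < t) : HasDerivAt u (deriv u t) t :=
  (((hu.contDiffOn hβ₁ hβ₂).differentiableOn two_ne_zero t ht).differentiableAt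
    (Ioi_mem_nhds ht)).hasDerivAt

lemma IsCaputoSolution.hasDerivAt_deriv (hβ₁ : 1 < β) (hβ₂ : β < 2)
    (hu : IsCaputoSolution β r a b u) {t : ℝ} (ht : 0 < t) :
    HasDerivAt (deriv u) (deriv (deriv u) t) t := by
  have h := (hu.contDiffOn hβ₁ hβ₂).deriv_of_isOpen (m := 1) isOpen_Ioi (by norm_num)
  exact ((h.differentiableOn one_ne_zero t ht).differentiableAt (Ioi_mem_nhds ht)).hasDerivAt

lemma IsCaputoSolution.continuousOn (hβ₁ : 1 < β) (hβ₂ : β < 2)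
    (hu : IsCaputoSolution β r a b u) : ContinuousOn u (Ici 0) := by
  intro t ht
  rcases (mem_Ici.1 ht).eq_or_lt with rfl | h
  · exact hu.init_deriv.continuousWithinAt
  · exact (hu.hasDerivAt hβ₁ hβ₂ h).continuousAt.continuousWithinAt

lemma IsCaputoSolution.intervalIntegrable_deriv_deriv (hβ₁ : 1 < β) (hβ₂ : β < 2)
    (hu : IsCaputoSolution β r a b u) {T : ℝ} (hT : 0 < T) :
    IntervalIntegrable (deriv (deriv u)) volume 0 T := by
  -- At the later time T + 1 the weight is nonsingular on [0, T] and can be divided out.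
  have h := hu.caputoDifferentiable.integrable (T + 1) (by linarith)
  rw [funext (caputoIntegrand_eq hβ₁ hβ₂ u (T + 1))] at h
  have h2 := h.mul_continuousOn (g := fun τ => (T + 1 - τ) ^ (β - 1))
    ((Real.continuous_rpow_const (by linarith)).comp (by fun_prop)).continuousOn
  have h3 := h2.mono_set (c := 0) (d := T) (by
    rw [uIcc_of_le hT.le, uIcc_of_le (by linarith)]
    exact Icc_subset_Icc_right (by linarith))
  refine h3.congr fun τ hτ => ?_
  rw [uIoc_of_le hT.le] at hτ
  have hpos : 0 < T + 1 - τ := by linarith [hτ.2]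
  have : (T + 1 - τ) ^ (2 - β - 1) * (T + 1 - τ) ^ (β - 1) = 1 := by
    rw [← Real.rpow_add hpos]
    ring_nf
    exact Real.rpow_zero _
  linear_combination (deriv (deriv u) τ) * this

/-- Integrability of u'' near 0 gives u' a limit at 0+, and this limit must be the one-sided
derivative prescribed at 0. -/
lemma IsCaputoSolution.tendsto_deriv (hβ₁ : 1 < β) (hβ₂ : β < 2)
    (hu : IsCaputoSolution β r a b u) : Tendsto (deriv u) (𝓝[>] 0) (𝓝 b) := by
  have hint := hu.intervalIntegrable_deriv_deriv hβ₁ hβ₂ one_pos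
  have hcont := (intervalIntegral.continuousOn_primitive_interval' hint left_mem_uIcc) 0
    left_mem_uIcc
  have hIoc : Ioc (0 : ℝ) 1 ∈ 𝓝[>] (0 : ℝ) := Ioc_mem_nhdsGT one_pos
  have hlim := (hcont.tendsto.mono_left (nhdsWithin_le_of_mem (mem_of_superset hIoc
    (by rw [uIcc_of_le zero_le_one]; exact Ioc_subset_Icc_self)))).const_add
      (deriv u 1 - ∫ x in 0..1, deriv (deriv u) x)
  have hlim2 : Tendsto (deriv u) (𝓝[>] 0) (𝓝 (deriv u 1 - ∫ x in 0..1, deriv (deriv u) x)) := by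
    simp only [intervalIntegral.integral_same, add_zero] at hlim
    refine hlim.congr' ?_
    filter_upwards [hIoc] with ε hε
    have hsub : ∀ c d : ℝ, c ∈ Icc (0 : ℝ) 1 → d ∈ Icc (0 : ℝ) 1 →
        IntervalIntegrable (deriv (deriv u)) volume c d := fun c d hc hd =>
      hint.mono_set (by
        rw [uIcc_of_le zero_le_one]
        exact uIcc_subset_Icc hc hd)
    have hε' : ε ∈ Icc (0 : ℝ) 1 := ⟨hε.1.le, hε.2⟩
    have e1 := intervalIntegral.integral_add_adjacent_intervals
      (hsub 0 ε (by simp) hε') (hsub ε 1 hε' (by simp))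
    have e2 := intervalIntegral.integral_eq_sub_of_hasDerivAt (a := ε) (b := 1)
      (fun x hx => hu.hasDerivAt_deriv hβ₁ hβ₂ (by
        rw [uIcc_of_le hε.2] at hx; exact hε.1.trans_le hx.1)) (hsub ε 1 hε' (by simp))
    linarith
  have hd := hasDerivWithinAt_Ici_of_tendsto_deriv (s := Ioi 0)
    (fun t ht => (hu.hasDerivAt hβ₁ hβ₂ ht).differentiableAt.differentiableWithinAt)
    (hu.init_deriv.continuousWithinAt.mono Ioi_subset_Ici_self) self_mem_nhdsWithin hlim2
  have := (uniqueDiffOn_Ici (0 : ℝ) 0 self_mem_Ici).eq_deriv _ hd hu.init_deriv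
  rwa [this] at hlim2

/-- Integration by parts with the primitive (T - s) u' + u, whose value at 0 is taken as a limit. -/
lemma IsCaputoSolution.integral_sub_mul_deriv_deriv (hβ₁ : 1 < β) (hβ₂ : β < 2)
    (hu : IsCaputoSolution β r a b u) {T : ℝ} (hT : 0 < T) :
    ∫ s in 0..T, (T - s) * deriv (deriv u) s = u T - a - b * T := by
  have hint : IntervalIntegrable (fun s => (T - s) * deriv (deriv u) s) volume 0 T :=
    (hu.intervalIntegrable_deriv_deriv hβ₁ hβ₂ hT).continuousOn_mul (by fun_prop)
  have hder : ∀ s, 0 < s → HasDerivAt (fun s => (T - s) * deriv u s + u s)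
      ((T - s) * deriv (deriv u) s) s := by
    intro s hs
    have h1 : HasDerivAt (fun s => T - s) (-1) s := by
      simpa using (hasDerivAt_id s).const_sub T
    refine ((h1.mul (hu.hasDerivAt_deriv hβ₁ hβ₂ hs)).add (hu.hasDerivAt hβ₁ hβ₂ hs)).congr_deriv ?_
    ring
  have h0 : Tendsto (fun s => (T - s) * deriv u s + u s) (𝓝[>] 0) (𝓝 ((T - 0) * b + a)) := by
    have h1 : Tendsto (fun s : ℝ => T - s) (𝓝[>] 0) (𝓝 (T - 0)) :=
      (Continuous.tendsto (by fun_prop) 0).mono_left nhdsWithin_le_nhds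
    have h2 : Tendsto u (𝓝[>] 0) (𝓝 a) := by
      rw [← hu.init]
      exact hu.init_deriv.continuousWithinAt.tendsto.mono_left
        (nhdsWithin_mono _ Ioi_subset_Ici_self)
    exact (h1.mul (hu.tendsto_deriv hβ₁ hβ₂)).add h2
  have h1 := (hder T hT).continuousAt.tendsto.mono_left (nhdsWithin_le_nhds (s := Iio T))
  rw [intervalIntegral.integral_eq_sub_of_hasDerivAt_of_tendsto hT (fun s hs => hder s hs.1) hint
    h0 h1]
  ring

/-- A solution of the Caputo problem solves the equivalent Volterra integral equation. -/
lemma IsCaputoSolution.eq_add_integral (hβ₁ : 1 < β) (hβ₂ : β < 2)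
    (hu : IsCaputoSolution β r a b u) {T : ℝ} (hT : 0 < T) :
    u T = a + b * T + r / Real.Gamma β * ∫ s in 0..T, (T - s) ^ (β - 1) * u s := by
  -- The orders β and 2 - β add up to 2, so the composite kernel is T - s.
  have hF := integral_rpow_mul_integral_rpow_mul (p := β) (q := 2 - β) (by linarith) (by linarith)
    (by linarith) hT (hu.intervalIntegrable_deriv_deriv hβ₁ hβ₂ hT)
  have hG1 := (Real.Gamma_pos_of_pos (show 0 < β by linarith)).ne'
  have hG2 := (Real.Gamma_pos_of_pos (show 0 < 2 - β by linarith)).ne'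
  have hinner : ∀ τ ∈ Ioc 0 T, (T - τ) ^ (β - 1) *
      (∫ s in 0..τ, (τ - s) ^ (2 - β - 1) * deriv (deriv u) s) =
      Real.Gamma (2 - β) * r * ((T - τ) ^ (β - 1) * u τ) := by
    intro τ hτ
    have h := hu.equation τ hτ.1
    rw [caputoDeriv_eq hβ₁ hβ₂, sub_eq_zero, one_div, inv_mul_eq_iff_eq_mul₀ hG2] at h
    rw [h]
    ring
  rw [intervalIntegral.integral_of_le hT.le, setIntegral_congr_fun measurableSet_Ioc hinner,
    ← intervalIntegral.integral_of_le hT.le, intervalIntegral.integral_const_mul] at hF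
  have e : (2 : ℝ) - β + β = 2 := by ring
  rw [e, Real.Gamma_two, show (2 : ℝ) - 1 = 1 by norm_num] at hF
  simp_rw [Real.rpow_one] at hF
  rw [hu.integral_sub_mul_deriv_deriv hβ₁ hβ₂ hT] at hF
  field_simp at hF ⊢
  linarith

lemma IsCaputoSolution.eqOn (hβ₁ : 1 < β) (hβ₂ : β < 2) {v : ℝ → ℝ}
    (hu : IsCaputoSolution β r a b u) (hv : IsCaputoSolution β r a b v) {t : ℝ} (ht : 0 ≤ t) :
    u t = v t := by
  have hcu := hu.continuousOn hβ₁ hβ₂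
  have hcv := hv.continuousOn hβ₁ hβ₂
  have hk : ∀ t : ℝ, Continuous fun s : ℝ => (t - s) ^ (β - 1) := fun t =>
    (Real.continuous_rpow_const (by linarith)).comp (by fun_prop)
  have hii : ∀ {f : ℝ → ℝ}, ContinuousOn f (Ici 0) → ∀ t, 0 ≤ t →
      IntervalIntegrable f volume 0 t := fun hf t ht =>
    (hf.mono (by rw [uIcc_of_le ht]; exact Icc_subset_Ici_self)).intervalIntegrable
  have hw := eq_zero_of_abs_le_integral (w := fun t => u t - v t) (hcu.sub hcv)
    -- On 0 ≤ s ≤ x ≤ t the kernel (x - s)^(β-1) is at most t^(β-1), because β > 1.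
    (K := |r / Real.Gamma β| * t ^ (β - 1)) (T := t) (fun x hx => ?_) t ⟨ht, le_rfl⟩
  · linarith
  · rcases hx.1.eq_or_lt with rfl | hx0
    · simp [hu.init, hv.init]
    · have e : u x - v x = r / Real.Gamma β * ∫ s in 0..x, (x - s) ^ (β - 1) * (u s - v s) := by
        rw [hu.eq_add_integral hβ₁ hβ₂ hx0, hv.eq_add_integral hβ₁ hβ₂ hx0]
        simp_rw [mul_sub]
        have hi : ∀ {f : ℝ → ℝ}, ContinuousOn f (Ici 0) →
            IntervalIntegrable (fun s => (x - s) ^ (β - 1) * f s) volume 0 x :=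
          fun hf => hii ((hk x).continuousOn.mul hf) x hx.1
        rw [intervalIntegral.integral_sub (hi hcu) (hi hcv)]
        ring
      rw [e, abs_mul, mul_assoc, ← intervalIntegral.integral_const_mul]
      gcongr
      refine (intervalIntegral.abs_integral_le_integral_abs hx.1).trans ?_
      refine intervalIntegral.integral_mono_on hx.1
        (hii ((hk x).continuousOn.mul (hcu.sub hcv)).abs x hx.1)
        (hii (continuousOn_const.mul (hcu.sub hcv).abs) x hx.1) fun s hs => ?_
      rw [abs_mul, abs_of_nonneg (Real.rpow_nonneg (by linarith [hs.2]) _)]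
      gcongr
      · linarith [hs.2]
      · linarith [hs.1, hx.2]

end Solution

/-! ### The explicit solution and its logarithmic derivative at infinity -/

lemma mittagLeffler_add_eq (β r t : ℝ) :
    mittagLeffler β (r * t ^ β) + t * mittagLeffler₂ β 2 (r * t ^ β) =
      mittagLefflerPower β r 1 t + mittagLefflerPower β r 2 t := by
  rw [mittagLefflerPower, mittagLefflerPower, mittagLeffler_eq, sub_self, Real.rpow_zero,
    show (2 : ℝ) - 1 = 1 by norm_num, Real.rpow_one, one_mul]

lemma hasDerivAt_mittagLefflerPower_add {β : ℝ} (hβ : 0 < β) (r γ δ : ℝ) {t : ℝ} (ht : 0 < t) :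
    HasDerivAt (fun t => mittagLefflerPower β r γ t + mittagLefflerPower β r δ t)
      (mittagLefflerPower β r (γ - 1) t + mittagLefflerPower β r (δ - 1) t) t :=
  (hasDerivAt_mittagLefflerPower hβ r γ ht).add (hasDerivAt_mittagLefflerPower hβ r δ ht)

lemma deriv_mittagLeffler_add {β : ℝ} (hβ : 0 < β) (r : ℝ) {t : ℝ} (ht : 0 < t) :
    deriv (fun t => mittagLeffler β (r * t ^ β) + t * mittagLeffler₂ β 2 (r * t ^ β)) t =
      mittagLefflerPower β r 0 t + mittagLefflerPower β r 1 t := by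
  have h := (hasDerivAt_mittagLefflerPower_add hβ r 1 2 ht).congr_of_eventuallyEq
    (eventually_of_mem (Ioi_mem_nhds ht) fun s _ => mittagLeffler_add_eq β r s)
  rw [h.deriv]
  norm_num

lemma deriv_deriv_mittagLeffler_add {β : ℝ} (hβ : 0 < β) (r : ℝ) {t : ℝ} (ht : 0 < t) :
    deriv (deriv fun t => mittagLeffler β (r * t ^ β) + t * mittagLeffler₂ β 2 (r * t ^ β)) t =
      r * (mittagLefflerPower β r (β - 1) t + mittagLefflerPower β r β t) := by
  have h := (hasDerivAt_mittagLefflerPower_add hβ r 0 1 ht).congr_of_eventuallyEq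
    (eventually_of_mem (Ioi_mem_nhds ht) fun _ hs => deriv_mittagLeffler_add hβ r hs)
  -- The poles of Γ at -1 and 0 remove the singular powers t^(-2) and t^(-1) from the second
  -- derivative.
  have hG : Real.Gamma (0 - 1) = 0 := by
    have := Real.Gamma_neg_nat_eq_zero 1
    rwa [Nat.cast_one, ← zero_sub] at this
  rw [h.deriv, mittagLefflerPower_eq_add hβ r (0 - 1) ht, mittagLefflerPower_eq_add hβ r (1 - 1) ht,
    hG, sub_self, Real.Gamma_zero, div_zero, div_zero, add_zero, zero_sub, ← sub_eq_add_neg]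
  ring

lemma isCaputoSolution_mittagLeffler {β : ℝ} (hβ₁ : 1 < β) (hβ₂ : β < 2) (r : ℝ) :
    IsCaputoSolution β r 1 1
      (fun t => mittagLeffler β (r * t ^ β) + t * mittagLeffler₂ β 2 (r * t ^ β)) := by
  have hβ : 0 < β := by linarith
  have hp : 0 < 2 - β := by linarith
  have hE : ∀ γ, mittagLeffler₂ β γ 0 = 1 / Real.Gamma γ := fun γ => by
    rw [mittagLeffler₂_eq_add hβ]; simp
  have hi1 := fun (t : ℝ) (ht : 0 < t) =>
    intervalIntegrable_rpow_mul_mittagLefflerPower hβ r hp (show 0 < β - 1 by linarith) ht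
  have hi2 := fun (t : ℝ) (ht : 0 < t) =>
    intervalIntegrable_rpow_mul_mittagLefflerPower hβ r hp hβ ht
  have hval : ∀ t τ : ℝ, 0 < τ → (t - τ) ^ (2 - β - 1) * deriv (deriv fun t =>
      mittagLeffler β (r * t ^ β) + t * mittagLeffler₂ β 2 (r * t ^ β)) τ =
      r * ((t - τ) ^ (2 - β - 1) * mittagLefflerPower β r (β - 1) τ +
        (t - τ) ^ (2 - β - 1) * mittagLefflerPower β r β τ) := fun t τ hτ => by
    rw [deriv_deriv_mittagLeffler_add hβ r hτ]; ring
  refine ⟨⟨?_, fun t ht => ?_⟩, fun t ht => ?_, ?_, ?_⟩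
  · exact ((contDiffOn_mittagLefflerPower hβ r _ 1).add
      (contDiffOn_mittagLefflerPower hβ r _ 2)).congr fun t _ => mittagLeffler_add_eq β r t
  · refine (((hi1 t ht).add (hi2 t ht)).const_mul r).congr fun τ hτ => ?_
    rw [uIoc_of_le ht.le] at hτ
    rw [caputoIntegrand_eq hβ₁ hβ₂, hval t τ hτ.1]
  · rw [caputoDeriv_eq hβ₁ hβ₂, intervalIntegral.integral_of_le ht.le,
      setIntegral_congr_fun measurableSet_Ioc fun τ hτ => hval t τ hτ.1,
      ← intervalIntegral.integral_of_le ht.le, intervalIntegral.integral_const_mul,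
      intervalIntegral.integral_add (hi1 t ht) (hi2 t ht),
      integral_rpow_mul_mittagLefflerPower hβ r hp (by linarith) ht,
      integral_rpow_mul_mittagLefflerPower hβ r hp hβ ht, mittagLeffler_add_eq,
      show β - 1 + (2 - β) = 1 by ring, show β + (2 - β) = 2 by ring]
    have := (Real.Gamma_pos_of_pos hp).ne'
    field_simp
    ring
  · rw [Real.zero_rpow hβ.ne', mul_zero, mittagLeffler_eq, hE]
    simp
  -- As β > 1, the arguments r t^β are stationary at 0, and the slope 1 comes only from the factor t
  -- times E_{β,2}(0) = 1.
  · have hpow : HasDerivAt (fun t : ℝ => r * t ^ β) 0 0 := by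
      have := (Real.hasDerivAt_rpow_const (x := 0) (p := β) (Or.inr hβ₁.le)).const_mul r
      rwa [Real.zero_rpow (by linarith), mul_zero, mul_zero] at this
    have hcomp : ∀ γ, HasDerivAt (fun t : ℝ => mittagLeffler₂ β γ (r * t ^ β)) 0 0 := fun γ => by
      have := (hasDerivAt_mittagLeffler₂ hβ γ (r * 0 ^ β)).comp (0 : ℝ) hpow
      rwa [mul_zero] at this
    have := (hcomp 1).add ((hasDerivAt_id (0 : ℝ)).mul (hcomp 2))
    refine (this.congr_deriv ?_).hasDerivWithinAt
    rw [Real.zero_rpow hβ.ne', mul_zero, hE]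
    simp

lemma tendsto_mul_deriv_div {β r : ℝ} (hβ₁ : 1 < β) (hβ₂ : β < 2) (hr : r < 0) :
    Tendsto (fun t => t * (mittagLefflerPower β r 0 t + mittagLefflerPower β r 1 t) /
      (mittagLefflerPower β r 1 t + mittagLefflerPower β r 2 t)) atTop (𝓝 (1 - β)) := by
  have hβ : 0 < β := by linarith
  have hx : Tendsto (fun t : ℝ => -r * t ^ β) atTop atTop :=
    (tendsto_rpow_atTop hβ).const_mul_atTop (neg_pos.2 hr)
  have hA : ∀ γ, Tendsto (fun t : ℝ => (-r * t ^ β) * mittagLeffler₂ β γ (r * t ^ β)) atTop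
      (𝓝 (1 / Real.Gamma (γ - β))) := fun γ => by
    refine ((tendsto_mul_mittagLeffler₂_neg hβ₁ hβ₂ γ).comp hx).congr fun t => ?_
    simp only [Function.comp_apply, neg_mul, neg_neg]
  have hinv := tendsto_inv_atTop_zero (𝕜 := ℝ)
  -- Numerator and denominator are both scaled by -r t^(β-1); the lower-index term of each then
  -- carries a factor 1/t and drops out.
  have hnum := (hinv.mul (hA 0)).add (hA 1)
  have hden := (hinv.mul (hA 1)).add (hA 2)
  rw [zero_mul, zero_add] at hnum hden
  have hG2 : 0 < Real.Gamma (2 - β) := Real.Gamma_pos_of_pos (by linarith)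
  have h := hnum.div hden (by positivity)
  have hlim : 1 / Real.Gamma (1 - β) / (1 / Real.Gamma (2 - β)) = 1 - β := by
    have := sub_one_div_Gamma (2 - β)
    rw [show (2 : ℝ) - β - 1 = 1 - β by ring] at this
    rw [← this]
    field_simp
  rw [hlim] at h
  refine h.congr' ?_
  filter_upwards [eventually_gt_atTop 0] with t ht
  have hc : -r * t ^ β * t⁻¹ ≠ 0 :=
    mul_ne_zero (mul_ne_zero (neg_pos.2 hr).ne' (Real.rpow_pos_of_pos ht β).ne') (inv_ne_zero ht.ne')
  simp only [Pi.div_apply, mittagLefflerPower]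
  rw [sub_self, Real.rpow_zero, show (2 : ℝ) - 1 = 1 by norm_num, Real.rpow_one, zero_sub,
    Real.rpow_neg_one]
  symm
  rw [← mul_div_mul_left _ _ hc]
  congr 1 <;> field_simp <;> ring

end

theorem theorem3 (β r : ℝ) (hβ₁ : 1 < β) (hβ₂ : β < 2) (hr : r < 0) :
    IsCaputoSolution β r 1 1
        (fun t => mittagLeffler β (r * t ^ β) + t * mittagLeffler₂ β 2 (r * t ^ β)) ∧
      ∀ u : ℝ → ℝ, IsCaputoSolution β r 1 1 u →
        (∀ t, 0 ≤ t →
          u t = mittagLeffler β (r * t ^ β) + t * mittagLeffler₂ β 2 (r * t ^ β)) ∧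
        ∃ L : ℝ, Tendsto (fun t => t * deriv u t / u t) atTop (𝓝 L) ∧ β = 1 - L := by
  have hsol := isCaputoSolution_mittagLeffler hβ₁ hβ₂ r
  refine ⟨hsol, fun u hu => ?_⟩
  have heq : ∀ t, 0 ≤ t →
      u t = mittagLeffler β (r * t ^ β) + t * mittagLeffler₂ β 2 (r * t ^ β) :=
    fun t ht => hu.eqOn hβ₁ hβ₂ hsol ht
  refine ⟨heq, 1 - β, (tendsto_mul_deriv_div hβ₁ hβ₂ hr).congr' ?_, by ring⟩
  filter_upwards [eventually_gt_atTop 0] with t ht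
  have hev : u =ᶠ[𝓝 t]
      fun t => mittagLeffler β (r * t ^ β) + t * mittagLeffler₂ β 2 (r * t ^ β) :=
    eventually_of_mem (Ioi_mem_nhds ht) fun s hs => heq s (le_of_lt hs)
  rw [hev.deriv_eq, deriv_mittagLeffler_add (by linarith) r ht, heq t ht.le,
    mittagLeffler_add_eq]
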